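/- Let $d\ge 1$, $\sigma>0$, $T>0$, and let $t\mapsto\lambda_t$ be a nondecreasing function on $[0,T]$ with $\lambda_t\in[0,1]$ and $\lambda_T=1$. For a Borel probability measure $\mu$ on $\mathbb{R}^d$ let the Poincaré constant $C_{\mathrm{PI}}(\mu)\in[0,\infty]$ be the infimum of all $C\ge 0$ such that $$\operatorname{Var}_\mu(f)\le C\int\|\nabla f\|^2\,d\mu\qquad\text{for all } f\in C_c^\infty(\mathbb{R}^d),$$ and let the log-Sobolev constant $C_{\mathrm{LSI}}(\mu)\in[0,\infty]$ be the infimum of all $C\ge 0$ such that $$\operatorname{Ent}_\mu(f^2)\le 2C\int\|\nabla f\|^2\,d\mu\qquad\text{for all } f\in C_c^\infty(\mathbb{R}^d),$$ where $\operatorname{Ent}_\mu(g)=\int g\log g\,d\mu-\left(\int g\,d\mu\right)\log\left(\int g\,d\mu\right)$ (with $0\log 0=0$; each constant is $+\infty$ if no finite $C$ is admissible). Let $\pi_{\mathrm{data}}$ be a probability measure on $\mathbb{R}^d$, let $\nu=\mathcal{N}(0,\sigma^2 I)$, and for $t\in[0,T]$ let $\mu_t$ be the law of $\sqrt{\lambda_t}\,X+\sqrt{1-\lambda_t}\,Z$,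 where $X\sim\pi_{\mathrm{data}}$ and $Z\sim\nu$ are independent. If $C_{\mathrm{LSI}}(\pi_{\mathrm{data}})<\infty$, then for all $t\in[0,T]$ $$C_{\mathrm{LSI}}(\mu_t)\le\lambda_t\,C_{\mathrm{LSI}}(\pi_{\mathrm{data}})+(1-\lambda_t)\,C_{\mathrm{LSI}}(\nu),$$ and if $C_{\mathrm{PI}}(\pi_{\mathrm{data}})<\infty$, then for all $t\in[0,T]$ $$C_{\mathrm{PI}}(\mu_t)\le\lambda_t\,C_{\mathrm{PI}}(\pi_{\mathrm{data}})+(1-\lambda_t)\,C_{\mathrm{PI}}(\nu).$$ Moreover $C_{\mathrm{LSI}}(\nu)=C_{\mathrm{PI}}(\nu)=\sigma^2$. -/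

import Mathlib

open MeasureTheory ProbabilityTheory Set
open scoped ENNReal NNReal ContDiff

noncomputable section

/-- `μ` satisfies the Poincaré inequality with constant `C`: `Var_μ(f) ≤ C · E_μ ‖∇f‖²` for every
test function `f ∈ C_c^∞(ℝᵈ)`. -/
def SatisfiesPoincare {d : ℕ} (μ : Measure (EuclideanSpace ℝ (Fin d))) (C : ℝ≥0) : Prop :=
  ∀ f : EuclideanSpace ℝ (Fin d) → ℝ, ContDiff ℝ ∞ f → HasCompactSupport f →
    variance f μ ≤ C * ∫ x, ‖gradient f x‖ ^ 2 ∂μ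

/-- The entropy functional `Ent_μ(g) = E_μ[g log g] - E_μ[g] log E_μ[g]` of a nonnegative function
(with `0 log 0 = 0`). -/
def entropyFunctional {Ω : Type*} [MeasurableSpace Ω] (μ : Measure Ω) (g : Ω → ℝ) : ℝ :=
  ∫ x, g x * Real.log (g x) ∂μ - (∫ x, g x ∂μ) * Real.log (∫ x, g x ∂μ)

/-- `μ` satisfies the log-Sobolev inequality with constant `C`:
`Ent_μ(f²) ≤ 2 C · E_μ ‖∇f‖²` for every test function `f ∈ C_c^∞(ℝᵈ)`. -/
def SatisfiesLogSobolev {d : ℕ} (μ : Measure (EuclideanSpace ℝ (Fin d))) (C : ℝ≥0) : Prop :=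
  ∀ f : EuclideanSpace ℝ (Fin d) → ℝ, ContDiff ℝ ∞ f → HasCompactSupport f →
    entropyFunctional μ (fun x => f x ^ 2) ≤ 2 * C * ∫ x, ‖gradient f x‖ ^ 2 ∂μ

/-- The Poincaré constant: the infimum of all admissible constants, `∞` if there is none. -/
def poincareConst {d : ℕ} (μ : Measure (EuclideanSpace ℝ (Fin d))) : ℝ≥0∞ :=
  ⨅ (C : ℝ≥0) (_ : SatisfiesPoincare μ C), (C : ℝ≥0∞)

/-- The log-Sobolev constant: the infimum of all admissible constants, `∞` if there is none. -/
def logSobolevConst {d : ℕ} (μ : Measure (EuclideanSpace ℝ (Fin d))) : ℝ≥0∞ :=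
  ⨅ (C : ℝ≥0) (_ : SatisfiesLogSobolev μ C), (C : ℝ≥0∞)

/-- The diffusion path between the base distribution `ν` and `π` with schedule `l`: at time `t` it
is the convolution of the law of `√(l t) X`, `X ∼ π`, with the law of `√(1 - l t) Z`, `Z ∼ ν`.
When the two scalings are nonzero and `π`, `ν` have densities `p`, `q`, it has the density
`l(t)^(-d/2) p(·/√l(t)) * (1-l(t))^(-d/2) q(·/√(1-l(t)))`. -/
def diffusionPath {d : ℕ} (π ν : Measure (EuclideanSpace ℝ (Fin d))) (l : ℝ → ℝ) (t : ℝ) :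
    Measure (EuclideanSpace ℝ (Fin d)) :=
  (π.map fun x => Real.sqrt (l t) • x).conv (ν.map fun z => Real.sqrt (1 - l t) • z)

/-- The isotropic Gaussian `N(0, σ² I)` on `ℝᵈ`. -/
def isotropicGaussian (d : ℕ) (σ : ℝ) : Measure (EuclideanSpace ℝ (Fin d)) :=
  multivariateGaussian 0 (σ ^ 2 • (1 : Matrix (Fin d) (Fin d) ℝ))

/-- A schedule on `[0, T]`: a nondecreasing function with values in `[0, 1]` and final value `1`. -/
structure IsSchedule (T : ℝ) (l : ℝ → ℝ) : Prop where
  monotoneOn : MonotoneOn l (Icc 0 T)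
  mem_Icc : ∀ t ∈ Icc 0 T, l t ∈ Icc (0 : ℝ) 1
  final : l T = 1

end

/-!
Both inequalities are instances of one: for a pair `(φ, ψ)` of real functions, bound the
`φ`-entropy `E[φ(ψ(f))] - φ(E[ψ(f)])` by `C · E ‖∇f‖²`. The pair `(u², u)` gives the variance and
the Poincaré inequality, the pair `(u log u / 2, u²)` gives half the entropy of `f²` and the
log-Sobolev inequality. All that is used about the pair is collected in `IsEntropyPair`.

*Convolution.* The `φ`-entropy tensorizes (`phiEntropy_prod_le`). Applied to
`(x, y) ↦ f (x + y)`, whose partial gradients are both `∇f (x + y)`, this shows that the constants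
add up under convolution (`SatisfiesPhiSobolev.conv`). Scaling by `c` multiplies the constant by
`c²`. As the infimum defining a finite constant is attained, the bound along the path follows
(`phiSobolevConst_interpolation_le`).

*The Gaussian, upper bound.* A Taylor expansion shows that a Gaussian of small variance `s`
satisfies the inequality for a fixed smooth function with constant `s`, up to an error
`O(s ^ (3 / 2))` that is uniform over translates (`exists_hasTranslateBound_scaledGaussian`).
The Gaussian of variance `t` is the `n`-fold convolution of the one of variance `t / n`, so by
additivity it satisfies the inequality with constant `t` and error `n · O((t / n) ^ (3 / 2))`, which
tends to zero. The expansion needs a function bounded away from zero: for the variance a constant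
is added, for the entropy `f` is replaced by `√(f² + ε²)` and `ε → 0`.

*The Gaussian, lower bound.* By cut-off the inequality extends to smooth functions with enough
moments (`SatisfiesPhiSobolev.le_of_integrable`), and linear functions, respectively exponentials
of linear functions, turn it into an equality.
-/

/-! ### Entropy pairs and tensorization -/

/-- The `φ`-entropy of `ψ ∘ f`, namely `E_μ[φ(ψ(f))] - φ(E_μ[ψ(f)])`. With `φ u = u ^ 2` and
`ψ u = u` this is the variance of `f`; with `φ u = u log u / 2` and `ψ u = u ^ 2` it is half the
entropy of `f ^ 2`. -/
noncomputable def phiEntropy {Ω : Type*} [MeasurableSpace Ω] (φ ψ : ℝ → ℝ) (μ : Measure Ω)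
    (f : Ω → ℝ) : ℝ :=
  ∫ x, φ (ψ (f x)) ∂μ - φ (∫ x, ψ (f x) ∂μ)

/-- The properties of a pair `(φ, ψ)` on which the Poincaré and the log-Sobolev inequalities for
convolutions and for Gaussian measures rest. The field `marginals` quantifies over `Type`, the
universe of `EuclideanSpace ℝ (Fin d)`. -/
structure IsEntropyPair (φ ψ : ℝ → ℝ) : Prop where
  continuous_phi : Continuous φ
  continuous_psi : Continuous ψ
  /-- Quartic growth: functions in `L⁴` have finite `φ`-entropy. -/
  growth : ∃ C, ∀ u, |ψ u| ≤ C * (1 + u ^ 4) ∧ |φ (ψ u)| ≤ C * (1 + u ^ 4)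
  /-- Comparison of a function on a product with its two marginals; it amounts to the
  tensorization of the `φ`-entropy. -/
  marginals : ∀ {Ω : Type} [MeasurableSpace Ω] (μ ν : Measure Ω) [IsProbabilityMeasure μ]
    [IsProbabilityMeasure ν] (F : Ω × Ω → ℝ) (R : ℝ), Measurable F → (∀ z, |F z| ≤ R) →
    ∫ x, φ (∫ y, ψ (F (x, y)) ∂ν) ∂μ + ∫ y, φ (∫ x, ψ (F (x, y)) ∂μ) ∂ν ≤
      ∫ z, φ (ψ (F z)) ∂(μ.prod ν) + φ (∫ z, ψ (F z) ∂(μ.prod ν))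
  /-- Second-order comparison: `φ` lies above its tangent at `ψ b`, and `φ ∘ ψ` exceeds this
  tangent by at most `(a - b) ^ 2` up to a cubic error. -/
  second_order : ∀ ε > 0, ∀ R, ∃ C, 0 ≤ C ∧ ∀ b ∈ Icc ε R, ∃ s,
    (∀ M, 0 ≤ M → φ (ψ b) + s * (M - ψ b) ≤ φ M) ∧
    ∀ a ∈ Icc ε R, 0 ≤ ψ a ∧
      φ (ψ a) ≤ φ (ψ b) + s * (ψ a - ψ b) + (a - b) ^ 2 + C * |a - b| ^ 3

theorem exists_bound_comp {h : ℝ → ℝ} (hh : Continuous h) (R : ℝ) :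
    ∃ B, ∀ u, |u| ≤ R → |h u| ≤ B := by
  obtain ⟨B, hB⟩ := (isCompact_Icc (a := -R) (b := R)).exists_bound_of_continuousOn hh.continuousOn
  exact ⟨B, fun u hu => hB u (abs_le.1 hu)⟩

theorem integrable_of_abs_le {Ω : Type*} [MeasurableSpace Ω] {μ : Measure Ω} [IsFiniteMeasure μ]
    {f : Ω → ℝ} {B : ℝ} (hf : Measurable f) (hB : ∀ x, |f x| ≤ B) : Integrable f μ :=
  Integrable.of_bound hf.aestronglyMeasurable B (ae_of_all _ hB)

theorem abs_integral_le_of_abs_le {Ω : Type*} [MeasurableSpace Ω] {μ : Measure Ω}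
    [IsProbabilityMeasure μ] {f : Ω → ℝ} {B : ℝ} (hB : ∀ x, |f x| ≤ B) : |∫ x, f x ∂μ| ≤ B := by
  simpa using norm_integral_le_of_norm_le_const (μ := μ) (f := f) (ae_of_all _ hB)

section Product

variable {Ω : Type} [MeasurableSpace Ω] {μ ν : Measure Ω} [IsProbabilityMeasure μ]
  [IsProbabilityMeasure ν] {φ ψ : ℝ → ℝ}

theorem measurable_integral_fst {g : Ω × Ω → ℝ} (hg : Measurable g) :
    Measurable fun y => ∫ x, g (x, y) ∂μ :=
  (hg.stronglyMeasurable.integral_prod_left' (μ := μ)).measurable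

theorem measurable_integral_snd {g : Ω × Ω → ℝ} (hg : Measurable g) :
    Measurable fun x => ∫ y, g (x, y) ∂ν :=
  (hg.stronglyMeasurable.integral_prod_right' (ν := ν)).measurable

theorem integrable_phi_marginal (hφ : Continuous φ) (hψ : Continuous ψ) {F : Ω × Ω → ℝ} {R : ℝ}
    (hF : Measurable F) (hR : ∀ z, |F z| ≤ R) :
    Integrable (fun y => φ (∫ x, ψ (F (x, y)) ∂μ)) ν := by
  obtain ⟨B, hB⟩ := exists_bound_comp hψ R
  obtain ⟨B', hB'⟩ := exists_bound_comp hφ B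
  exact integrable_of_abs_le
    (hφ.measurable.comp (measurable_integral_fst (hψ.measurable.comp hF)))
    (fun y => hB' _ (abs_integral_le_of_abs_le fun x => hB _ (hR _)))

theorem integrable_phiEntropy_section (hφ : Continuous φ) (hψ : Continuous ψ) {F : Ω × Ω → ℝ}
    {R : ℝ} (hF : Measurable F) (hR : ∀ z, |F z| ≤ R) :
    Integrable (fun y => phiEntropy φ ψ μ fun x => F (x, y)) ν := by
  refine Integrable.sub ?_ (integrable_phi_marginal hφ hψ hF hR)
  exact integrable_phi_marginal (φ := id) continuous_id (hφ.comp hψ) hF hR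

/-- Tensorization of the `φ`-entropy. -/
theorem phiEntropy_prod_le (hp : IsEntropyPair φ ψ) {F : Ω × Ω → ℝ} {R : ℝ}
    (hF : Measurable F) (hR : ∀ z, |F z| ≤ R) :
    phiEntropy φ ψ (μ.prod ν) F ≤
      ∫ y, phiEntropy φ ψ μ (fun x => F (x, y)) ∂ν +
        ∫ x, phiEntropy φ ψ ν (fun y => F (x, y)) ∂μ := by
  have hφ := hp.continuous_phi
  have hψ := hp.continuous_psi
  have hF' : Measurable fun z : Ω × Ω => F (z.2, z.1) := hF.comp measurable_swap
  have hR' : ∀ z : Ω × Ω, |F (z.2, z.1)| ≤ R := fun z => hR _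
  obtain ⟨B, hB⟩ := exists_bound_comp (hφ.comp hψ) R
  have hint : Integrable (fun z => φ (ψ (F z))) (μ.prod ν) :=
    integrable_of_abs_le ((hφ.comp hψ).measurable.comp hF) (fun z => hB _ (hR z))
  have h := hp.marginals μ ν F R hF hR
  simp only [phiEntropy]
  have e1 : ∫ y, ∫ x, φ (ψ (F (x, y))) ∂μ ∂ν = ∫ z, φ (ψ (F z)) ∂(μ.prod ν) :=
    (integral_prod_symm _ hint).symm
  have e2 : ∫ x, ∫ y, φ (ψ (F (x, y))) ∂ν ∂μ = ∫ z, φ (ψ (F z)) ∂(μ.prod ν) :=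
    (integral_prod _ hint).symm
  have i1 : Integrable (fun y => ∫ x, φ (ψ (F (x, y))) ∂μ) ν :=
    integrable_phi_marginal (φ := id) continuous_id (hφ.comp hψ) hF hR
  have i2 : Integrable (fun x => ∫ y, φ (ψ (F (x, y))) ∂ν) μ :=
    integrable_phi_marginal (φ := id) continuous_id (hφ.comp hψ) hF' hR'
  rw [integral_sub i1 (integrable_phi_marginal hφ hψ hF hR),
    integral_sub i2 (integrable_phi_marginal hφ hψ hF' hR'), e1, e2]
  linarith

end Product

/-! ### The two entropy pairs -/

theorem isEntropyPair_variance : IsEntropyPair (fun u => u ^ 2) (fun u => u) where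
  continuous_phi := by fun_prop
  continuous_psi := by fun_prop
  growth := ⟨1, fun u => ⟨by
    rw [abs_le]
    constructor <;> nlinarith [sq_nonneg (u ^ 2 - 1), sq_nonneg (u - 1), sq_nonneg (u + 1)], by
    rw [abs_of_nonneg (sq_nonneg u)]; nlinarith [sq_nonneg (u ^ 2 - 1)]⟩⟩
  marginals := by
    intro Ω _ μ ν _ _ F R hF hR
    have hFi : Integrable F (μ.prod ν) := integrable_of_abs_le hF hR
    set m : Ω → ℝ := fun x => ∫ y, F (x, y) ∂ν with hm
    set b : Ω → ℝ := fun y => ∫ x, F (x, y) ∂μ with hb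
    set M := ∫ z, F z ∂(μ.prod ν) with hM
    have hmm : Measurable m := measurable_integral_snd hF
    have hbm : Measurable b := measurable_integral_fst hF
    have hmR : ∀ x, |m x| ≤ R := fun x => abs_integral_le_of_abs_le fun y => hR _
    have hbR : ∀ y, |b y| ≤ R := fun x => abs_integral_le_of_abs_le fun y => hR _
    have hmM : ∫ x, m x ∂μ = M := (integral_prod _ hFi).symm
    have hbM : ∫ y, b y ∂ν = M := (integral_prod_symm _ hFi).symm
    have hmul : ∀ {Ω : Type} [MeasurableSpace Ω] {κ : Measure Ω} [IsProbabilityMeasure κ]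
        {u v : Ω → ℝ}, Measurable u → Measurable v → (∀ x, |u x| ≤ R) → (∀ x, |v x| ≤ R) →
        Integrable (fun x => u x * v x) κ := by
      intro Ω _ κ _ u v hu hv hu' hv'
      refine integrable_of_abs_le (B := R * R) (hu.mul hv) fun x => ?_
      rw [abs_mul]
      exact mul_le_mul (hu' x) (hv' x) (abs_nonneg _) ((abs_nonneg _).trans (hu' x))
    have hm1 : Measurable fun z : Ω × Ω => m z.1 := hmm.comp measurable_fst
    have hb2 : Measurable fun z : Ω × Ω => b z.2 := hbm.comp measurable_snd
    have I1 : Integrable (fun z => F z * F z) (μ.prod ν) := hmul hF hF hR hR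
    have I2 : Integrable (fun z => F z * m z.1) (μ.prod ν) := hmul hF hm1 hR fun _ => hmR _
    have I3 : Integrable (fun z => F z * b z.2) (μ.prod ν) := hmul hF hb2 hR fun _ => hbR _
    have I4 : Integrable (fun z : Ω × Ω => m z.1 * m z.1) (μ.prod ν) :=
      hmul hm1 hm1 (fun _ => hmR _) fun _ => hmR _
    have I5 : Integrable (fun z : Ω × Ω => b z.2 * b z.2) (μ.prod ν) :=
      hmul hb2 hb2 (fun _ => hbR _) fun _ => hbR _
    have I6 : Integrable (fun z : Ω × Ω => m z.1 * b z.2) (μ.prod ν) :=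
      hmul hm1 hb2 (fun _ => hmR _) fun _ => hbR _
    have I7 : Integrable (fun z : Ω × Ω => m z.1) (μ.prod ν) :=
      integrable_of_abs_le hm1 fun _ => hmR _
    have I8 : Integrable (fun z : Ω × Ω => b z.2) (μ.prod ν) :=
      integrable_of_abs_le hb2 fun _ => hbR _
    have E2 : ∫ z, F z * m z.1 ∂(μ.prod ν) = ∫ x, m x ^ 2 ∂μ := by
      rw [integral_prod _ I2]
      exact integral_congr_ae (ae_of_all _ fun x => by
        simp only [integral_mul_const, hm]; ring)
    have E3 : ∫ z, F z * b z.2 ∂(μ.prod ν) = ∫ y, b y ^ 2 ∂ν := by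
      rw [integral_prod_symm _ I3]
      exact integral_congr_ae (ae_of_all _ fun x => by
        simp only [integral_mul_const, hb]; ring)
    have E4 : ∫ z : Ω × Ω, m z.1 * m z.1 ∂(μ.prod ν) = ∫ x, m x ^ 2 ∂μ := by
      rw [integral_prod _ I4]; simp [sq]
    have E5 : ∫ z : Ω × Ω, b z.2 * b z.2 ∂(μ.prod ν) = ∫ y, b y ^ 2 ∂ν := by
      rw [integral_prod_symm _ I5]; simp [sq]
    have E6 : ∫ z : Ω × Ω, m z.1 * b z.2 ∂(μ.prod ν) = M * M := by
      rw [integral_prod_mul m b, hmM, hbM]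
    have E7 : ∫ z : Ω × Ω, m z.1 ∂(μ.prod ν) = M := by
      rw [integral_prod _ I7]; simpa using hmM
    have E8 : ∫ z : Ω × Ω, b z.2 ∂(μ.prod ν) = M := by
      rw [integral_prod_symm _ I8]; simpa using hbM
    have E1 : ∫ z, F z ^ 2 ∂(μ.prod ν) = ∫ z, F z * F z ∂(μ.prod ν) := by simp [sq]
    have I7' : Integrable (fun z : Ω × Ω => 2 * M * m z.1) (μ.prod ν) := I7.const_mul _
    have I8' : Integrable (fun z : Ω × Ω => 2 * M * b z.2) (μ.prod ν) := I8.const_mul _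
    clear hmul
    clear_value m b M
    -- the integral of `(F z - m z.1 - b z.2 + M) ^ 2`, expanded
    have key : 0 ≤ ∫ z : Ω × Ω, (F z * F z - 2 * (F z * m z.1) - 2 * (F z * b z.2) +
        m z.1 * m z.1 + b z.2 * b z.2 + 2 * (m z.1 * b z.2) + 2 * M * F z - 2 * M * m z.1 -
        2 * M * b z.2 + M * M) ∂(μ.prod ν) := by
      refine integral_nonneg fun z => ?_
      have : F z * F z - 2 * (F z * m z.1) - 2 * (F z * b z.2) + m z.1 * m z.1 + b z.2 * b z.2 +
          2 * (m z.1 * b z.2) + 2 * M * F z - 2 * M * m z.1 - 2 * M * b z.2 + M * M =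
          (F z - m z.1 - b z.2 + M) ^ 2 := by ring
      exact this ▸ sq_nonneg (F z - m z.1 - b z.2 + M)
    rw [integral_add (by fun_prop) (by fun_prop), integral_sub (by fun_prop) (by fun_prop),
      integral_sub (by fun_prop) (by fun_prop), integral_add (by fun_prop) (by fun_prop),
      integral_add (by fun_prop) (by fun_prop), integral_add (by fun_prop) (by fun_prop),
      integral_add (by fun_prop) (by fun_prop), integral_sub (by fun_prop) (by fun_prop),
      integral_sub (by fun_prop) (by fun_prop)] at key
    simp only [integral_const_mul, integral_const, probReal_univ, one_smul, E2, E3, E4, E5, E6,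
      E7, E8, ← E1, ← hM] at key
    subst hm hb
    linarith
  second_order := by
    intro ε hε R
    refine ⟨0, le_rfl, fun b hb => ⟨2 * b, fun M _ => ?_, fun a ha => ⟨hε.le.trans ha.1, ?_⟩⟩⟩
    · nlinarith [sq_nonneg (M - b)]
    · nlinarith

/-- Young's inequality: `u log u` lies above its tangent at `v`, also at `u = 0`. -/
theorem mul_log_ge {u v : ℝ} (hu : 0 ≤ u) (hv : 0 < v) :
    u * Real.log v + u - v ≤ u * Real.log u := by
  rcases hu.eq_or_lt with rfl | hu
  · simp [hv.le]
  · have := Real.log_le_sub_one_of_pos (div_pos hv hu)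
    rw [Real.log_div hv.ne' hu.ne'] at this
    have h2 := mul_le_mul_of_nonneg_left this hu.le
    have : u * (v / u - 1) = v - u := by field_simp
    linarith

theorem log_one_add_le_cubic {t : ℝ} (ht : -1 < t) :
    Real.log (1 + t) ≤ t - t ^ 2 / 2 + t ^ 3 / 3 := by
  have hder : ∀ x : ℝ, -1 < x → HasDerivAt
      (fun x : ℝ => x - x ^ 2 / 2 + x ^ 3 / 3 - Real.log (1 + x))
      (1 - x + x ^ 2 - 1 / (1 + x)) x := by
    intro x hx
    have h1 : HasDerivAt (fun x : ℝ => Real.log (1 + x)) (1 / (1 + x)) x :=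
      ((hasDerivAt_id x).const_add 1).log (by simp; linarith)
    refine ((((hasDerivAt_id x).sub ((hasDerivAt_pow 2 x).div_const 2)).add
      ((hasDerivAt_pow 3 x).div_const 3)).sub h1).congr_deriv ?_
    norm_num
  have hval : ∀ x : ℝ, -1 < x → 1 - x + x ^ 2 - 1 / (1 + x) = x ^ 3 / (1 + x) := by
    intro x hx
    have : (1 + x) ≠ 0 := by linarith
    field_simp; ring
  have hcont : ∀ x : ℝ, -1 < x → ContinuousAt
      (fun x : ℝ => x - x ^ 2 / 2 + x ^ 3 / 3 - Real.log (1 + x)) x :=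
    fun x hx => (hder x hx).continuousAt
  suffices h : (fun x : ℝ => x - x ^ 2 / 2 + x ^ 3 / 3 - Real.log (1 + x)) 0 ≤
      (fun x : ℝ => x - x ^ 2 / 2 + x ^ 3 / 3 - Real.log (1 + x)) t by
    norm_num at h; linarith
  rcases le_total 0 t with h0 | h0
  · refine monotoneOn_of_deriv_nonneg (convex_Icc 0 t) (fun x hx =>
      (hcont x (by linarith [hx.1])).continuousWithinAt) (fun x hx => ?_) (fun x hx => ?_)
      (left_mem_Icc.2 h0) (right_mem_Icc.2 h0) h0
    all_goals rw [interior_Icc] at hx; have hx' : -1 < x := by linarith [hx.1]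
    · exact (hder x hx').differentiableAt.differentiableWithinAt
    · rw [(hder x hx').deriv, hval x hx']
      have := hx.1
      positivity
  · refine antitoneOn_of_deriv_nonpos (convex_Icc t 0) (fun x hx =>
      (hcont x (by linarith [hx.1])).continuousWithinAt) (fun x hx => ?_) (fun x hx => ?_)
      (left_mem_Icc.2 h0) (right_mem_Icc.2 h0) h0
    all_goals rw [interior_Icc] at hx; have hx' : -1 < x := by linarith [hx.1]
    · exact (hder x hx').differentiableAt.differentiableWithinAt
    · rw [(hder x hx').deriv, hval x hx']
      exact div_nonpos_of_nonpos_of_nonneg (by nlinarith [hx.2, sq_nonneg x]) (by linarith)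

theorem abs_mul_log_le {s : ℝ} (hs : 0 ≤ s) : |s * Real.log s| ≤ 1 + s ^ 2 := by
  have h1 := mul_log_ge hs one_pos
  have h2 : s * Real.log s ≤ s * s :=
    mul_le_mul_of_nonneg_left (Real.log_le_self hs) hs
  rw [Real.log_one] at h1
  rw [abs_le]
  constructor <;> nlinarith

/-- With marginals `m`, `b` and total mass `M`, this says that the relative entropy of `g` with
respect to `m ⊗ b / M` is nonnegative: it is the integral of Young's inequality `mul_log_ge` at
`u = g (x, y)` and `v = m x * b y / M`. -/
theorem integral_mul_log_marginals_le {Ω : Type*} [MeasurableSpace Ω] {μ ν : Measure Ω}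
    [IsProbabilityMeasure μ] [IsProbabilityMeasure ν] {g : Ω × Ω → ℝ} {R : ℝ}
    (hg : Measurable g) (h0 : ∀ z, 0 ≤ g z) (hR : ∀ z, g z ≤ R) :
    ∫ x, (∫ y, g (x, y) ∂ν) * Real.log (∫ y, g (x, y) ∂ν) ∂μ +
        ∫ y, (∫ x, g (x, y) ∂μ) * Real.log (∫ x, g (x, y) ∂μ) ∂ν ≤
      ∫ z, g z * Real.log (g z) ∂(μ.prod ν) +
        (∫ z, g z ∂(μ.prod ν)) * Real.log (∫ z, g z ∂(μ.prod ν)) := by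
  have hgR : ∀ z, |g z| ≤ R := fun z => by rw [abs_of_nonneg (h0 z)]; exact hR z
  have hgi : Integrable g (μ.prod ν) := integrable_of_abs_le hg hgR
  obtain ⟨m, hm⟩ : ∃ m : Ω → ℝ, m = fun x => ∫ y, g (x, y) ∂ν := ⟨_, rfl⟩
  obtain ⟨b, hb⟩ : ∃ b : Ω → ℝ, b = fun y => ∫ x, g (x, y) ∂μ := ⟨_, rfl⟩
  obtain ⟨M, hM⟩ : ∃ M : ℝ, M = ∫ z, g z ∂(μ.prod ν) := ⟨_, rfl⟩
  have hmm : Measurable m := hm ▸ (hg.stronglyMeasurable.integral_prod_right' (ν := ν)).measurable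
  have hbm : Measurable b := hb ▸ (hg.stronglyMeasurable.integral_prod_left' (μ := μ)).measurable
  have hm0 : ∀ x, 0 ≤ m x := fun x => hm ▸ integral_nonneg fun y => h0 _
  have hb0 : ∀ y, 0 ≤ b y := fun y => hb ▸ integral_nonneg fun x => h0 _
  have hM0 : 0 ≤ M := hM ▸ integral_nonneg h0
  have hmR : ∀ x, |m x| ≤ R := fun x => hm ▸ abs_integral_le_of_abs_le fun y => hgR _
  have hbR : ∀ y, |b y| ≤ R := fun x => hb ▸ abs_integral_le_of_abs_le fun y => hgR _
  have hmi : Integrable m μ := integrable_of_abs_le hmm hmR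
  have hbi : Integrable b ν := integrable_of_abs_le hbm hbR
  have hmM : ∫ x, m x ∂μ = M := by rw [hM, hm]; exact (integral_prod _ hgi).symm
  have hbM : ∫ y, b y ∂ν = M := by rw [hM, hb]; exact (integral_prod_symm _ hgi).symm
  obtain ⟨B, hB⟩ := exists_bound_comp Real.continuous_mul_log R
  have hφm : Measurable fun u : ℝ => u * Real.log u := Real.continuous_mul_log.measurable
  have iA : Integrable (fun z => g z * Real.log (g z)) (μ.prod ν) :=
    integrable_of_abs_le (hφm.comp hg) fun z => hB _ (hgR z)
  have im : Integrable (fun x => m x * Real.log (m x)) μ :=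
    integrable_of_abs_le (hφm.comp hmm) fun z => hB _ (hmR z)
  have ib : Integrable (fun x => b x * Real.log (b x)) ν :=
    integrable_of_abs_le (hφm.comp hbm) fun z => hB _ (hbR z)
  -- The marginals may vanish; adding `ε` to each of them keeps every logarithm bounded.
  have key : ∀ ε : ℝ, 0 < ε → ∫ x, m x * Real.log (m x) ∂μ + ∫ y, b y * Real.log (b y) ∂ν ≤
      ∫ z, g z * Real.log (g z) ∂(μ.prod ν) + (M * Real.log (M + ε) + ε) := by
    intro ε hε
    have hlog : ∀ u : ℝ, 0 ≤ u → u * Real.log u ≤ u * Real.log (u + ε) := by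
      intro u hu
      rcases hu.eq_or_lt with rfl | hu'
      · simp
      · exact mul_le_mul_of_nonneg_left (Real.log_le_log hu' (by linarith)) hu
    obtain ⟨L, hL⟩ : ∃ L, ∀ u, 0 ≤ u → |u| ≤ R → |Real.log (u + ε)| ≤ L := by
      have : ContinuousOn (fun u => Real.log (u + ε)) (Icc 0 R) := fun u hu =>
        ((continuousAt_id.add continuousAt_const).log
          (by simp; linarith [hu.1])).continuousWithinAt
      obtain ⟨L, hL⟩ := isCompact_Icc.exists_bound_of_continuousOn this
      exact ⟨L, fun u h0 hu => hL u ⟨h0, (le_abs_self u).trans hu⟩⟩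
    have hR0 : 0 ≤ R := by
      obtain ⟨x⟩ : Nonempty Ω := μ.nonempty_of_neZero
      exact (abs_nonneg _).trans (hmR x)
    have imul : ∀ {Ω : Type _} [MeasurableSpace Ω] {κ : Measure Ω} [IsProbabilityMeasure κ]
        {u v : Ω → ℝ}, Measurable u → Measurable v → (∀ x, |u x| ≤ R) → (∀ x, 0 ≤ v x) →
        (∀ x, |v x| ≤ R) → Integrable (fun x => u x * Real.log (v x + ε)) κ := by
      intro Ω _ κ _ u v hu hv hu' hv0 hv'
      refine integrable_of_abs_le (B := R * L)
        (hu.mul (Real.measurable_log.comp (hv.add_const _))) fun x => ?_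
      rw [abs_mul]
      exact mul_le_mul (hu' x) (hL _ (hv0 x) (hv' x)) (abs_nonneg _) hR0
    have hm1 : Measurable fun z : Ω × Ω => m z.1 := hmm.comp measurable_fst
    have hb2 : Measurable fun z : Ω × Ω => b z.2 := hbm.comp measurable_snd
    have I1 : Integrable (fun z => g z * Real.log (m z.1 + ε)) (μ.prod ν) :=
      imul hg hm1 hgR (fun _ => hm0 _) fun _ => hmR _
    have I2 : Integrable (fun z => g z * Real.log (b z.2 + ε)) (μ.prod ν) :=
      imul hg hb2 hgR (fun _ => hb0 _) fun _ => hbR _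
    have E1 : ∫ z, g z * Real.log (m z.1 + ε) ∂(μ.prod ν) =
        ∫ x, m x * Real.log (m x + ε) ∂μ := by
      rw [integral_prod _ I1]
      exact integral_congr_ae (ae_of_all _ fun x => by simp only [integral_mul_const, hm])
    have E2 : ∫ z, g z * Real.log (b z.2 + ε) ∂(μ.prod ν) =
        ∫ y, b y * Real.log (b y + ε) ∂ν := by
      rw [integral_prod_symm _ I2]
      exact integral_congr_ae (ae_of_all _ fun x => by simp only [integral_mul_const, hb])
    have F1 : ∫ x, m x * Real.log (m x) ∂μ ≤ ∫ x, m x * Real.log (m x + ε) ∂μ :=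
      integral_mono im (imul hmm hmm hmR hm0 hmR) fun x => hlog _ (hm0 x)
    have F2 : ∫ x, b x * Real.log (b x) ∂ν ≤ ∫ x, b x * Real.log (b x + ε) ∂ν :=
      integral_mono ib (imul hbm hbm hbR hb0 hbR) fun x => hlog _ (hb0 x)
    have I3 : Integrable (fun z : Ω × Ω => (m z.1 + ε) * (b z.2 + ε)) (μ.prod ν) :=
      (hmi.add (integrable_const ε)).mul_prod (hbi.add (integrable_const ε))
    have E3 : ∫ z : Ω × Ω, (m z.1 + ε) * (b z.2 + ε) ∂(μ.prod ν) = (M + ε) * (M + ε) := by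
      rw [integral_prod_mul (fun x => m x + ε) (fun y => b y + ε),
        integral_add hmi (integrable_const _), integral_add hbi (integrable_const _)]
      simp [hmM, hbM]
    have hMε : 0 < M + ε := by linarith
    have I4 : Integrable (fun z : Ω × Ω => (m z.1 + ε) * (b z.2 + ε) / (M + ε)) (μ.prod ν) :=
      I3.div_const _
    have I5 : Integrable (fun z => g z * Real.log (M + ε)) (μ.prod ν) := hgi.mul_const _
    have pt : ∀ z, g z * Real.log (m z.1 + ε) + g z * Real.log (b z.2 + ε) -
        g z * Real.log (M + ε) + g z - (m z.1 + ε) * (b z.2 + ε) / (M + ε) ≤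
        g z * Real.log (g z) := by
      intro z
      have p1 : 0 < m z.1 + ε := by linarith [hm0 z.1]
      have p2 : 0 < b z.2 + ε := by linarith [hb0 z.2]
      have := mul_log_ge (h0 z) (div_pos (mul_pos p1 p2) hMε)
      rw [Real.log_div (mul_pos p1 p2).ne' hMε.ne', Real.log_mul p1.ne' p2.ne'] at this
      linarith
    have J1 : Integrable (fun z => g z * Real.log (m z.1 + ε) + g z * Real.log (b z.2 + ε))
      (μ.prod ν) := I1.add I2
    have J2 : Integrable (fun z => g z * Real.log (m z.1 + ε) + g z * Real.log (b z.2 + ε) -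
      g z * Real.log (M + ε)) (μ.prod ν) := J1.sub I5
    have J3 : Integrable (fun z => g z * Real.log (m z.1 + ε) + g z * Real.log (b z.2 + ε) -
      g z * Real.log (M + ε) + g z) (μ.prod ν) := J2.add hgi
    have := integral_mono (J3.sub I4) iA pt
    have e : ∫ z, (g z * Real.log (m z.1 + ε) + g z * Real.log (b z.2 + ε) -
        g z * Real.log (M + ε) + g z - (m z.1 + ε) * (b z.2 + ε) / (M + ε)) ∂(μ.prod ν) =
        ∫ x, m x * Real.log (m x + ε) ∂μ + ∫ y, b y * Real.log (b y + ε) ∂ν -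
          M * Real.log (M + ε) + M - (M + ε) := by
      rw [integral_sub J3 I4, integral_add J2 hgi, integral_sub J1 I5, integral_add I1 I2,
        E1, E2, integral_mul_const,
        integral_div, E3, ← hM, mul_div_cancel_right₀ _ hMε.ne']
    have this' := e.symm.le.trans this
    linarith
  have lim : Filter.Tendsto (fun ε : ℝ => ∫ z, g z * Real.log (g z) ∂(μ.prod ν) +
      (M * Real.log (M + ε) + ε)) (nhdsWithin 0 (Ioi 0))
      (nhds (∫ z, g z * Real.log (g z) ∂(μ.prod ν) + (M * Real.log (M + 0) + 0))) := by
    refine Filter.Tendsto.mono_left ?_ nhdsWithin_le_nhds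
    refine tendsto_const_nhds.add (Filter.Tendsto.add ?_ Filter.tendsto_id)
    rcases hM0.eq_or_lt with h | h
    · simp [← h]
    · refine tendsto_const_nhds.mul ?_
      have : ContinuousAt (fun ε => Real.log (M + ε)) 0 :=
        (continuousAt_const.add continuousAt_id).log (by simpa using h.ne')
      exact this.tendsto
  have := ge_of_tendsto lim (eventually_mem_nhdsWithin.mono fun ε hε => key ε hε)
  rw [add_zero, add_zero] at this
  subst hm hb hM
  exact this

theorem isEntropyPair_entropy : IsEntropyPair (fun u => u * Real.log u / 2) (fun u => u ^ 2) where
  continuous_phi := Real.continuous_mul_log.div_const 2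
  continuous_psi := by fun_prop
  growth := by
    refine ⟨1, fun u => ⟨?_, ?_⟩⟩
    · rw [abs_of_nonneg (sq_nonneg u)]; nlinarith [sq_nonneg (u ^ 2 - 1)]
    · have := abs_mul_log_le (sq_nonneg u)
      rw [abs_div, abs_two]
      nlinarith [abs_nonneg (u ^ 2 * Real.log (u ^ 2))]
  marginals := by
    intro Ω _ μ ν _ _ F R hF hR
    have := integral_mul_log_marginals_le (μ := μ) (ν := ν) (g := fun z => F z ^ 2) (R := R ^ 2)
      (hF.pow_const 2) (fun z => sq_nonneg _)
      (fun z => sq_le_sq' (abs_le.1 (hR z)).1 (abs_le.1 (hR z)).2)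
    simp only [integral_div]
    linarith
  second_order := by
    intro ε hε R
    refine ⟨(1 + R / ε + (R / ε) ^ 2) / ε,
      div_nonneg (by nlinarith [sq_nonneg (R / ε + 1), sq_nonneg (R / ε)]) hε.le, fun b hb =>
      ⟨(Real.log (b ^ 2) + 1) / 2, fun M hM => ?_, fun a ha => ⟨sq_nonneg a, ?_⟩⟩⟩
    · have hb0 : 0 < b := hε.trans_le hb.1
      have := mul_log_ge hM (pow_pos hb0 2)
      linarith
    · have hb0 : 0 < b := hε.trans_le hb.1
      have ha0 : 0 < a := hε.trans_le ha.1
      obtain ⟨t, ht⟩ : ∃ t, t = a / b - 1 := ⟨_, rfl⟩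
      have hab : a = b * (1 + t) := by rw [ht]; field_simp; ring
      have h1t : 0 < 1 + t := by rw [ht]; simp; positivity
      have hR0 : 0 ≤ R / ε := div_nonneg (hb0.le.trans hb.2) hε.le
      have htabs : |a - b| = b * |t| := by
        rw [hab, show b * (1 + t) - b = b * t by ring, abs_mul, abs_of_pos hb0]
      have htR : |t| ≤ R / ε := by
        have h1 : |a - b| ≤ R := abs_le.2 ⟨by linarith [hb.2], by linarith [ha.2]⟩
        have h2 : |t| = |a - b| / b := by rw [htabs]; field_simp
        rw [h2]
        exact div_le_div₀ ((abs_nonneg _).trans h1) h1 hε hb.1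
      have hlog := log_one_add_le_cubic (show -1 < t by linarith)
      have hla : Real.log (a ^ 2) = Real.log (b ^ 2) + 2 * Real.log (1 + t) := by
        rw [hab, mul_pow, Real.log_mul (by positivity) (by positivity),
          Real.log_pow (n := 2) (x := 1 + t)]
        norm_num
      -- the cubic Taylor remainder after inserting the bound for the logarithm
      have h3 : (1 + t) ^ 2 * Real.log (1 + t) - ((1 + t) ^ 2 - 1) / 2 ≤
          t ^ 2 + |t| ^ 3 * (1 + R / ε + (R / ε) ^ 2) := by
        have h4 := mul_le_mul_of_nonneg_left hlog (sq_nonneg (1 + t))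
        have h5 : (1 + t) ^ 2 * (t - t ^ 2 / 2 + t ^ 3 / 3) - ((1 + t) ^ 2 - 1) / 2 =
            t ^ 2 + t ^ 3 * (1 / 3 + t / 6 + t ^ 2 / 3) := by ring
        have h6 : t ^ 3 * (1 / 3 + t / 6 + t ^ 2 / 3) ≤
            |t| ^ 3 * (1 + R / ε + (R / ε) ^ 2) := by
          refine (le_abs_self _).trans ?_
          rw [abs_mul, abs_pow]
          refine mul_le_mul_of_nonneg_left ?_ (by positivity)
          have h7 : t ^ 2 ≤ (R / ε) ^ 2 := by
            rw [← sq_abs]; exact pow_le_pow_left₀ (abs_nonneg _) htR 2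
          rw [abs_le]
          constructor <;> nlinarith [(abs_le.1 htR).1, (abs_le.1 htR).2, sq_nonneg t]
        linarith
      have h8 : b ^ 2 * |t| ^ 3 ≤ |a - b| ^ 3 / ε := by
        rw [htabs, le_div_iff₀ hε]
        have : b ^ 2 * |t| ^ 3 * ε ≤ b ^ 2 * |t| ^ 3 * b :=
          mul_le_mul_of_nonneg_left hb.1 (by positivity)
        linarith [this, show b ^ 2 * |t| ^ 3 * b = (b * |t|) ^ 3 by ring]
      have h9 := mul_le_mul_of_nonneg_left h3 (sq_nonneg b)
      have h10 := mul_le_mul_of_nonneg_right h8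
        (show 0 ≤ 1 + R / ε + (R / ε) ^ 2 by positivity)
      have h11 : (1 + R / ε + (R / ε) ^ 2) / ε * |a - b| ^ 3 =
        |a - b| ^ 3 / ε * (1 + R / ε + (R / ε) ^ 2) := by ring
      have h12 : (a - b) ^ 2 = b ^ 2 * t ^ 2 := by rw [hab]; ring
      have h13 : a ^ 2 = b ^ 2 * (1 + t) ^ 2 := by rw [hab]; ring
      rw [h11, h12, hla, h13]
      nlinarith [h9, h10]

/-! ### Functional inequalities under convolution and scaling -/

section Convolution

theorem exists_abs_le_of_hasCompactSupport {E : Type*} [NormedAddCommGroup E] [NormedSpace ℝ E]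
    {f : E → ℝ} (hf : ContDiff ℝ ∞ f)
    (hc : HasCompactSupport f) :
    ∃ R L, (∀ x, |f x| ≤ R) ∧ ∀ x, ‖fderiv ℝ f x‖ ≤ L := by
  obtain ⟨R, hR⟩ := hc.exists_bound_of_continuous hf.continuous
  obtain ⟨L, hL⟩ := (hc.fderiv (𝕜 := ℝ)).exists_bound_of_continuous
    (hf.continuous_fderiv (by simp))
  exact ⟨R, L, hR, hL⟩

theorem norm_gradient_eq {E : Type*} [NormedAddCommGroup E] [InnerProductSpace ℝ E]
    [CompleteSpace E] (f : E → ℝ) (x : E) : ‖gradient f x‖ = ‖fderiv ℝ f x‖ := by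
  simp [gradient]

variable {E : Type} [NormedAddCommGroup E] [InnerProductSpace ℝ E] [FiniteDimensional ℝ E]
  [MeasurableSpace E] {φ ψ : ℝ → ℝ} {μ ν : Measure E}

/-- The functional inequality `Ent_φ(ψ ∘ f) ≤ C · E_μ ‖∇f‖²` for all `f ∈ C_c^∞`. -/
def SatisfiesPhiSobolev (φ ψ : ℝ → ℝ) (μ : Measure E) (C : ℝ) : Prop :=
  ∀ f : E → ℝ, ContDiff ℝ ∞ f → HasCompactSupport f →
    phiEntropy φ ψ μ f ≤ C * ∫ x, ‖gradient f x‖ ^ 2 ∂μ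

/-- The functional inequality for all translates of one function `F`, with an additive error `δ`. -/
def HasTranslateBound (φ ψ : ℝ → ℝ) (μ : Measure E) (F : E → ℝ) (a δ : ℝ) : Prop :=
  ∀ y, phiEntropy φ ψ μ (fun x => F (y + x)) ≤ a * ∫ x, ‖fderiv ℝ F (y + x)‖ ^ 2 ∂μ + δ

theorem SatisfiesPhiSobolev.hasTranslateBound {C : ℝ} (h : SatisfiesPhiSobolev φ ψ μ C)
    {f : E → ℝ} (hf : ContDiff ℝ ∞ f) (hc : HasCompactSupport f) :
    HasTranslateBound φ ψ μ f C 0 := by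
  intro y
  have := h (fun x => f (y + x)) (hf.comp (by fun_prop))
    (hc.comp_homeomorph (Homeomorph.addLeft y))
  simpa only [norm_gradient_eq, fderiv_comp_add_left, add_zero] using this

variable [BorelSpace E]

theorem phiEntropy_map (hφ : Continuous φ) (hψ : Continuous ψ) {Ω Ω' : Type*} [MeasurableSpace Ω]
    [MeasurableSpace Ω'] {κ : Measure Ω} {T : Ω → Ω'} (hT : Measurable T) {f : Ω' → ℝ}
    (hf : Measurable f) : phiEntropy φ ψ (κ.map T) f = phiEntropy φ ψ κ fun x => f (T x) := by
  unfold phiEntropy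
  have h1 : Measurable fun x => φ (ψ (f x)) := (hφ.comp hψ).measurable.comp hf
  have h2 : Measurable fun x => ψ (f x) := hψ.measurable.comp hf
  rw [integral_map hT.aemeasurable h1.aestronglyMeasurable,
    integral_map hT.aemeasurable h2.aestronglyMeasurable]

theorem HasTranslateBound.conv [IsProbabilityMeasure μ] [IsProbabilityMeasure ν]
    (hp : IsEntropyPair φ ψ) {F : E → ℝ} {R L a b δ ε : ℝ}
    (hF : Continuous F) (hR : ∀ x, |F x| ≤ R) (hF' : Continuous (fderiv ℝ F))
    (hL : ∀ x, ‖fderiv ℝ F x‖ ≤ L) (hμ : HasTranslateBound φ ψ μ F a δ)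
    (hν : HasTranslateBound φ ψ ν F b ε) :
    HasTranslateBound φ ψ (μ.conv ν) F (a + b) (δ + ε) := by
  intro y
  have hφ := hp.continuous_phi
  have hψ := hp.continuous_psi
  have hadd : Measurable fun z : E × E => z.1 + z.2 := by fun_prop
  have hm1 : Measurable fun z : E × E => F (y + (z.1 + z.2)) :=
    (hF.comp (by fun_prop)).measurable
  have hm2 : Measurable fun z : E × E => F (y + (z.2 + z.1)) :=
    (hF.comp (by fun_prop)).measurable
  have hg : Continuous fun x => ‖fderiv ℝ F x‖ ^ 2 := hF'.norm.pow 2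
  have hgB : ∀ x, |‖fderiv ℝ F x‖ ^ 2| ≤ L ^ 2 := fun x => by
    rw [abs_of_nonneg (sq_nonneg _)]
    exact pow_le_pow_left₀ (norm_nonneg _) (hL x) 2
  have hi : Integrable (fun z : E × E => ‖fderiv ℝ F (y + (z.1 + z.2))‖ ^ 2) (μ.prod ν) :=
    integrable_of_abs_le
      (hg.comp (by fun_prop : Continuous fun z : E × E => y + (z.1 + z.2))).measurable
      fun _ => hgB _
  have e : ∫ x, ‖fderiv ℝ F (y + x)‖ ^ 2 ∂(μ.conv ν) =
      ∫ z : E × E, ‖fderiv ℝ F (y + (z.1 + z.2))‖ ^ 2 ∂(μ.prod ν) := by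
    rw [Measure.conv, integral_map hadd.aemeasurable]
    exact (hg.comp (by fun_prop)).aestronglyMeasurable
  have hFy : Continuous fun x => F (y + x) := hF.comp (by fun_prop)
  rw [e, Measure.conv, phiEntropy_map hφ hψ hadd hFy.measurable]
  refine (phiEntropy_prod_le hp hm1 fun _ => hR _).trans ?_
  have b1 : ∫ w, phiEntropy φ ψ μ (fun x => F (y + (x + w))) ∂ν ≤
      ∫ w, (a * ∫ x, ‖fderiv ℝ F (y + (x + w))‖ ^ 2 ∂μ + δ) ∂ν := by
    refine integral_mono (integrable_phiEntropy_section hφ hψ hm1 fun _ => hR _)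
      ((hi.integral_prod_right.const_mul a).add (integrable_const δ)) fun w => ?_
    simpa only [show ∀ x, y + w + x = y + (x + w) from fun x => by abel] using hμ (y + w)
  have b2 : ∫ x, phiEntropy φ ψ ν (fun w => F (y + (x + w))) ∂μ ≤
      ∫ x, (b * ∫ w, ‖fderiv ℝ F (y + (x + w))‖ ^ 2 ∂ν + ε) ∂μ := by
    refine integral_mono (integrable_phiEntropy_section hφ hψ hm2 fun _ => hR _)
      ((hi.integral_prod_left.const_mul b).add (integrable_const ε)) fun w => ?_
    simpa only [add_assoc] using hν (y + w)
  rw [integral_add (hi.integral_prod_right.const_mul a) (integrable_const δ), integral_const_mul,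
    ← integral_prod_symm _ hi] at b1
  rw [integral_add (hi.integral_prod_left.const_mul b) (integrable_const ε), integral_const_mul,
    ← integral_prod _ hi] at b2
  simp only [integral_const, probReal_univ, one_smul] at b1 b2
  linarith

/-- Subadditivity of the constant under convolution. -/
theorem SatisfiesPhiSobolev.conv [IsProbabilityMeasure μ] [IsProbabilityMeasure ν]
    (hp : IsEntropyPair φ ψ) {A B : ℝ} (hμ : SatisfiesPhiSobolev φ ψ μ A)
    (hν : SatisfiesPhiSobolev φ ψ ν B) : SatisfiesPhiSobolev φ ψ (μ.conv ν) (A + B) := by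
  intro f hf hc
  obtain ⟨R, L, hR, hL⟩ := exists_abs_le_of_hasCompactSupport hf hc
  have := (hμ.hasTranslateBound hf hc).conv hp hf.continuous hR
    (hf.continuous_fderiv (by simp)) hL (hν.hasTranslateBound hf hc) 0
  simpa only [norm_gradient_eq, zero_add, add_zero] using this

theorem phiEntropy_dirac {Ω : Type*} [MeasurableSpace Ω] [MeasurableSingletonClass Ω] (x : Ω)
    (f : Ω → ℝ) : phiEntropy φ ψ (Measure.dirac x) f = 0 := by
  simp [phiEntropy]

/-- Scaling by `c` multiplies the constant by `c ^ 2`. -/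
theorem SatisfiesPhiSobolev.map_smul [IsProbabilityMeasure μ] (hφ : Continuous φ)
    (hψ : Continuous ψ) {A : ℝ} (hμ : SatisfiesPhiSobolev φ ψ μ A) (c : ℝ) :
    SatisfiesPhiSobolev φ ψ (μ.map fun x => c • x) (c ^ 2 * A) := by
  intro f hf hc
  rcases eq_or_ne c 0 with rfl | hc0
  · simp [phiEntropy_dirac]
  have hT : Measurable fun x : E => c • x := by fun_prop
  have hcont : Continuous (fderiv ℝ f) := hf.continuous_fderiv (by simp)
  have hd : ∀ x, ‖fderiv ℝ (fun x => f (c • x)) x‖ ^ 2 = c ^ 2 * ‖fderiv ℝ f (c • x)‖ ^ 2 := by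
    intro x
    rw [fderiv_comp_smul, norm_smul, mul_pow, Real.norm_eq_abs, sq_abs]
  have := hμ (fun x => f (c • x)) (hf.comp (by fun_prop))
    (hc.comp_homeomorph (Homeomorph.smulOfNeZero c hc0))
  simp only [norm_gradient_eq, hd, integral_const_mul] at this
  rw [phiEntropy_map hφ hψ hT hf.continuous.measurable]
  simp only [norm_gradient_eq]
  have hg : Continuous fun x => ‖fderiv ℝ f x‖ ^ 2 := hcont.norm.pow 2
  rw [integral_map hT.aemeasurable hg.aestronglyMeasurable]
  linarith

end Convolution

/-! ### Gaussian measures: the inequality with the sharp constant -/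

section Gaussian

theorem exists_regularity_bounds {E : Type*} [NormedAddCommGroup E] [NormedSpace ℝ E]
    {F : E → ℝ} {c : ℝ} (hF : ContDiff ℝ ∞ F) (hc : HasCompactSupport fun x => F x - c) :
    ∃ R L M, 0 ≤ L ∧ 0 ≤ M ∧ (∀ x, |F x| ≤ R) ∧ (∀ x, ‖fderiv ℝ F x‖ ≤ L) ∧
      ∀ x y, ‖fderiv ℝ F x - fderiv ℝ F y‖ ≤ M * ‖x - y‖ := by
  have hg : ContDiff ℝ ∞ fun x => F x - c := hF.sub contDiff_const
  have hd : fderiv ℝ (fun x => F x - c) = fderiv ℝ F := by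
    ext1 x; rw [fderiv_sub_const]
  obtain ⟨R, L, hR, hL⟩ := exists_abs_le_of_hasCompactSupport hg hc
  have hg' : ContDiff ℝ 1 (fderiv ℝ F) := (hF.fderiv_right (m := ∞) (by simp)).of_le (by simp)
  obtain ⟨M, hM⟩ := hg'.lipschitzWith_of_hasCompactSupport
    (by rw [← hd]; exact hc.fderiv (𝕜 := ℝ)) one_ne_zero
  rw [hd] at hL
  refine ⟨R + |c|, L, M, (norm_nonneg _).trans (hL 0), M.2, fun x => ?_, hL, fun x y => ?_⟩
  · have := abs_add_le (F x - c) c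
    rw [sub_add_cancel] at this
    linarith [hR x]
  · exact hM.norm_sub_le x y

/-- First-order Taylor expansion with quadratic remainder. -/
theorem norm_taylor_le {E : Type*} [NormedAddCommGroup E] [NormedSpace ℝ E]
    {F : E → ℝ} {M : ℝ} (hF : Differentiable ℝ F)
    (hM : ∀ x y, ‖fderiv ℝ F x - fderiv ℝ F y‖ ≤ M * ‖x - y‖) (hM0 : 0 ≤ M) (y v : E) :
    |F (y + v) - F y - fderiv ℝ F y v| ≤ M * ‖v‖ ^ 2 := by
  have := (convex_segment y (y + v)).norm_image_sub_le_of_norm_hasFDerivWithin_le'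
    (f := F) (f' := fderiv ℝ F) (φ := fderiv ℝ F y) (C := M * ‖v‖)
    (fun x _ => (hF x).hasFDerivAt.hasFDerivWithinAt) (fun x hx => ?_)
    (left_mem_segment ℝ y (y + v)) (right_mem_segment ℝ y (y + v))
  · rw [add_sub_cancel_left, Real.norm_eq_abs] at this
    linarith [this, show M * ‖v‖ * ‖v‖ = M * ‖v‖ ^ 2 by ring]
  · refine (hM x y).trans (mul_le_mul_of_nonneg_left ?_ hM0)
    obtain ⟨θ, hθ, rfl⟩ := (segment_eq_image' ℝ y (y + v) ▸ hx :)
    rw [add_sub_cancel_left, add_sub_cancel_left, norm_smul, Real.norm_of_nonneg hθ.1]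
    exact mul_le_of_le_one_left (norm_nonneg _) hθ.2

variable {E : Type} [NormedAddCommGroup E] [InnerProductSpace ℝ E] [FiniteDimensional ℝ E]
  [MeasurableSpace E] [BorelSpace E] {φ ψ : ℝ → ℝ}

/-- The centred Gaussian measure with covariance `s • 1`. -/
noncomputable def scaledGaussian (E : Type) [NormedAddCommGroup E] [InnerProductSpace ℝ E]
    [FiniteDimensional ℝ E] [MeasurableSpace E] [BorelSpace E] (s : ℝ) : Measure E :=
  (stdGaussian E).map fun x => Real.sqrt s • x

instance isProbabilityMeasure_scaledGaussian (s : ℝ) :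
    IsProbabilityMeasure (scaledGaussian E s) :=
  Measure.isProbabilityMeasure_map (by fun_prop)

theorem charFun_scaledGaussian {s : ℝ} (hs : 0 ≤ s) (t : E) :
    charFun (scaledGaussian E s) t = Complex.exp (-(s * ‖t‖ ^ 2) / 2) := by
  rw [scaledGaussian, charFun_map_smul, charFun_stdGaussian, norm_smul,
    Real.norm_of_nonneg (Real.sqrt_nonneg s)]
  congr 2
  push_cast
  rw [mul_pow, ← Complex.ofReal_pow, Real.sq_sqrt hs]

theorem scaledGaussian_conv {s t : ℝ} (hs : 0 ≤ s) (ht : 0 ≤ t) :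
    (scaledGaussian E s).conv (scaledGaussian E t) = scaledGaussian E (s + t) := by
  refine Measure.ext_of_charFun (funext fun u => ?_)
  rw [charFun_conv, charFun_scaledGaussian hs, charFun_scaledGaussian ht,
    charFun_scaledGaussian (add_nonneg hs ht), ← Complex.exp_add]
  congr 1
  push_cast
  ring

theorem integrable_norm_pow_stdGaussian (k : ℕ) :
    Integrable (fun x : E => ‖x‖ ^ k) (stdGaussian E) := by
  rcases eq_or_ne k 0 with rfl | hk
  · simp
  · exact (IsGaussian.memLp_id (stdGaussian E) k (by simp)).integrable_norm_pow hk

theorem integral_sq_dual_stdGaussian (L : StrongDual ℝ E) :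
    ∫ x, L x ^ 2 ∂(stdGaussian E) = ‖L‖ ^ 2 := by
  rw [← variance_dual_stdGaussian, variance_of_integral_eq_zero (by fun_prop)]
  exact integral_strongDual_stdGaussian L

/-- For a Gaussian of small variance `s` the functional inequality holds with constant `s`, up to an
error of order `s ^ (3 / 2)`. -/
theorem exists_hasTranslateBound_scaledGaussian (hp : IsEntropyPair φ ψ) {F : E → ℝ} {c ε : ℝ}
    (hF : ContDiff ℝ ∞ F) (hc : HasCompactSupport fun x => F x - c) (hε : 0 < ε)
    (hFε : ∀ x, ε ≤ F x) :
    ∃ K, ∀ s, 0 ≤ s → HasTranslateBound φ ψ (scaledGaussian E s) F s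
      (K * (s * Real.sqrt s + s ^ 2)) := by
  obtain ⟨R, L, M, hL0, hM0, hR, hL, hM⟩ := exists_regularity_bounds hF hc
  obtain ⟨C, hC0, hC⟩ := hp.second_order ε hε R
  have hφ := hp.continuous_phi
  have hψ := hp.continuous_psi
  have hFI : ∀ x, F x ∈ Icc ε R := fun x => ⟨hFε x, (le_abs_self _).trans (hR x)⟩
  have hFc : Continuous F := hF.continuous
  have hF'c : Continuous (fderiv ℝ F) := hF.continuous_fderiv (by simp)
  -- the moments of the norm; with `r = √s` the error terms are of order `r ^ 3` and `r ^ 4`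
  obtain ⟨m, hm⟩ : ∃ m : ℕ → ℝ, m = fun k => ∫ x : E, ‖x‖ ^ k ∂(stdGaussian E) := ⟨_, rfl⟩
  have hm0 : ∀ k, 0 ≤ m k := fun k => hm ▸ integral_nonneg fun x => by positivity
  have hi := integrable_norm_pow_stdGaussian (E := E)
  refine ⟨2 * L * M * m 1 + (2 * L * M + C * L ^ 3) * m 3 + M ^ 2 * m 4, fun s hs y => ?_⟩
  set r := Real.sqrt s with hr
  have hr0 : 0 ≤ r := Real.sqrt_nonneg s
  have hrs : r ^ 2 = s := Real.sq_sqrt hs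
  have hT : Measurable fun x : E => r • x := by fun_prop
  have hFy : Continuous fun x => F (y + x) := hFc.comp (by fun_prop)
  have hgy : Continuous fun x => ‖fderiv ℝ F (y + x)‖ ^ 2 :=
    (hF'c.comp (by fun_prop : Continuous fun x => y + x)).norm.pow 2
  rw [scaledGaussian, ← hr, phiEntropy_map hφ hψ hT hFy.measurable,
    integral_map hT.aemeasurable hgy.aestronglyMeasurable]
  set A := fderiv ℝ F y with hA
  have hFyr : Continuous fun x => F (y + r • x) := hFc.comp (by fun_prop)
  have hgyr : Continuous fun x => ‖fderiv ℝ F (y + r • x)‖ ^ 2 :=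
    (hF'c.comp (by fun_prop : Continuous fun x => y + r • x)).norm.pow 2
  -- replace the entropy by its second-order bound around `F y`
  obtain ⟨sl, hsl, hup⟩ := hC (F y) (hFI y)
  obtain ⟨B, hB⟩ := exists_bound_comp hψ R
  obtain ⟨B', hB'⟩ := exists_bound_comp (hφ.comp hψ) R
  have iψ : Integrable (fun x => ψ (F (y + r • x))) (stdGaussian E) :=
    integrable_of_abs_le (hψ.comp hFyr).measurable fun x => hB _ (hR _)
  have iφ : Integrable (fun x => φ (ψ (F (y + r • x)))) (stdGaussian E) :=
    integrable_of_abs_le (hφ.comp (hψ.comp hFyr)).measurable fun x => hB' _ (hR _)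
  -- the tangent inequality, evaluated at the mean of `ψ ∘ F`
  have h1 := hsl (∫ x, ψ (F (y + r • x)) ∂(stdGaussian E))
    (integral_nonneg fun x => (hup _ (hFI _)).1)
  have iA : Integrable (fun x => A x ^ 2) (stdGaussian E) :=
    (IsGaussian.memLp_dual (stdGaussian E) A 2 (by simp)).integrable_sq
  have pt : ∀ x, φ (ψ (F (y + r • x))) ≤ φ (ψ (F y)) + sl * (ψ (F (y + r • x)) - ψ (F y)) +
      (r ^ 2 * A x ^ 2 + ((2 * L * M + C * L ^ 3) * r ^ 3 * ‖x‖ ^ 3 +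
        M ^ 2 * r ^ 4 * ‖x‖ ^ 4)) := by
    intro x
    have h2 := (hup _ (hFI (y + r • x))).2
    have h3 := norm_taylor_le (hF.differentiable (by simp)) hM hM0 y (r • x)
    have h4 : |F (y + r • x) - F y| ≤ L * (r * ‖x‖) := by
      have := convex_univ.norm_image_sub_le_of_norm_fderiv_le (f := F) (𝕜 := ℝ) (C := L)
        (fun z _ => (hF.differentiable (by simp)) z) (fun z _ => hL z) (mem_univ y)
        (mem_univ (y + r • x))
      rwa [add_sub_cancel_left, norm_smul, Real.norm_of_nonneg hr0] at this
    have h5 : |F (y + r • x) - F y| ^ 3 ≤ (L * (r * ‖x‖)) ^ 3 :=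
      pow_le_pow_left₀ (abs_nonneg _) h4 3
    rw [norm_smul, Real.norm_of_nonneg hr0, ← hA, map_smul, smul_eq_mul] at h3
    have h6 : |A x| ≤ L * ‖x‖ := (A.le_opNorm x).trans
      (mul_le_mul_of_nonneg_right (hL y) (norm_nonneg _))
    have h7 : (F (y + r • x) - F y) ^ 2 ≤
        r ^ 2 * A x ^ 2 + 2 * L * M * r ^ 3 * ‖x‖ ^ 3 + M ^ 2 * r ^ 4 * ‖x‖ ^ 4 := by
      set e := F (y + r • x) - F y - r * A x with he
      have e1 : F (y + r • x) - F y = r * A x + e := by rw [he]; ring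
      have e2 : e ^ 2 ≤ (M * (r * ‖x‖) ^ 2) ^ 2 := by
        rw [← sq_abs]; exact pow_le_pow_left₀ (abs_nonneg _) h3 2
      have e3 : r * A x * e ≤ r * (L * ‖x‖) * (M * (r * ‖x‖) ^ 2) := by
        refine (le_abs_self _).trans ?_
        rw [abs_mul, abs_mul, abs_of_nonneg hr0]
        gcongr
      rw [e1]
      nlinarith
    have h8 := mul_le_mul_of_nonneg_left h5 hC0
    nlinarith
  have i3 := (hi 3).const_mul ((2 * L * M + C * L ^ 3) * r ^ 3)
  have i4 := (hi 4).const_mul (M ^ 2 * r ^ 4)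
  have j1 : Integrable (fun x => sl * (ψ (F (y + r • x)) - ψ (F y))) (stdGaussian E) :=
    (iψ.sub (integrable_const _)).const_mul sl
  have j2 : Integrable (fun x => φ (ψ (F y)) + sl * (ψ (F (y + r • x)) - ψ (F y)))
    (stdGaussian E) := (integrable_const _).add j1
  have j3 : Integrable (fun x : E => (2 * L * M + C * L ^ 3) * r ^ 3 * ‖x‖ ^ 3 +
    M ^ 2 * r ^ 4 * ‖x‖ ^ 4) (stdGaussian E) := i3.add i4
  have j4 : Integrable (fun x : E => r ^ 2 * A x ^ 2 + ((2 * L * M + C * L ^ 3) * r ^ 3 * ‖x‖ ^ 3 +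
    M ^ 2 * r ^ 4 * ‖x‖ ^ 4)) (stdGaussian E) := (iA.const_mul _).add j3
  have h9 := integral_mono iφ (j2.add j4) pt
  have e9 : ∫ x, (φ (ψ (F y)) + sl * (ψ (F (y + r • x)) - ψ (F y)) +
      (r ^ 2 * A x ^ 2 + ((2 * L * M + C * L ^ 3) * r ^ 3 * ‖x‖ ^ 3 + M ^ 2 * r ^ 4 * ‖x‖ ^ 4)))
      ∂(stdGaussian E) = φ (ψ (F y)) +
      sl * (∫ x, ψ (F (y + r • x)) ∂(stdGaussian E) - ψ (F y)) +
      (r ^ 2 * ‖A‖ ^ 2 + ((2 * L * M + C * L ^ 3) * r ^ 3 * m 3 + M ^ 2 * r ^ 4 * m 4)) := by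
    rw [integral_add j2 j4, integral_add (integrable_const _) j1,
      integral_add (iA.const_mul _) j3, integral_add i3 i4, integral_const_mul,
      integral_sub iψ (integrable_const _), integral_const_mul, integral_const_mul,
      integral_const_mul, integral_sq_dual_stdGaussian, hm]
    simp
  have h9' := h9.trans_eq e9
  -- compare the gradient at `y` with the average gradient
  have i1 := hi 1
  have ig : Integrable (fun x => ‖fderiv ℝ F (y + r • x)‖ ^ 2) (stdGaussian E) :=
    integrable_of_abs_le (B := L ^ 2) hgyr.measurable fun x => by
      rw [abs_of_nonneg (sq_nonneg _)]
      exact pow_le_pow_left₀ (norm_nonneg _) (hL _) 2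
  have h10 : ‖A‖ ^ 2 ≤ ∫ x, ‖fderiv ℝ F (y + r • x)‖ ^ 2 ∂(stdGaussian E) +
      2 * L * M * r * m 1 := by
    have pt2 : ∀ x : E, ‖A‖ ^ 2 ≤ ‖fderiv ℝ F (y + r • x)‖ ^ 2 + 2 * L * M * r * ‖x‖ ^ 1 := by
      intro x
      have k1 := hM y (y + r • x)
      rw [← hA, sub_add_cancel_left, norm_neg, norm_smul, Real.norm_of_nonneg hr0] at k1
      have k2 := (norm_sub_norm_le A (fderiv ℝ F (y + r • x))).trans k1
      have k3 : ‖A‖ + ‖fderiv ℝ F (y + r • x)‖ ≤ 2 * L := by linarith [hL y, hL (y + r • x)]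
      have k4 : (‖A‖ - ‖fderiv ℝ F (y + r • x)‖) * (‖A‖ + ‖fderiv ℝ F (y + r • x)‖) ≤
          (M * (r * ‖x‖)) * (2 * L) := by
        refine (mul_le_mul_of_nonneg_right k2 (by positivity)).trans
          (mul_le_mul_of_nonneg_left k3 (by positivity))
      nlinarith
    have := integral_mono (integrable_const (μ := stdGaussian E) (‖A‖ ^ 2))
      (ig.add (i1.const_mul (2 * L * M * r))) pt2
    have e : ∫ x, (‖fderiv ℝ F (y + r • x)‖ ^ 2 + 2 * L * M * r * ‖x‖ ^ 1) ∂(stdGaussian E) =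
        ∫ x, ‖fderiv ℝ F (y + r • x)‖ ^ 2 ∂(stdGaussian E) + 2 * L * M * r * m 1 := by
      rw [integral_add ig (i1.const_mul _), integral_const_mul, hm]
    have this' := this.trans_eq e
    simpa using this'
  have h11 := mul_le_mul_of_nonneg_left h10 (sq_nonneg r)
  unfold phiEntropy
  rw [← hrs]
  have hr3 : 0 ≤ r ^ 3 := by positivity
  have hr4 : 0 ≤ r ^ 4 := by positivity
  have q1 : 0 ≤ 2 * L * M * m 1 := by have := hm0 1; positivity
  have q3 : 0 ≤ (2 * L * M + C * L ^ 3) * m 3 := by have := hm0 3; positivity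
  have q4 : 0 ≤ M ^ 2 * m 4 := by have := hm0 4; positivity
  nlinarith [mul_nonneg q1 hr4, mul_nonneg q3 hr4, mul_nonneg q4 hr3]

/-- Adding up the inequality over the `n` summands of a Gaussian. -/
theorem HasTranslateBound.scaledGaussian_mul (hp : IsEntropyPair φ ψ) {F : E → ℝ} {R L s δ : ℝ}
    (hF : Continuous F) (hR : ∀ x, |F x| ≤ R) (hF' : Continuous (fderiv ℝ F))
    (hL : ∀ x, ‖fderiv ℝ F x‖ ≤ L) (hs : 0 ≤ s)
    (h : HasTranslateBound φ ψ (scaledGaussian E s) F s δ) (n : ℕ) :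
    HasTranslateBound φ ψ (scaledGaussian E ((n + 1 : ℕ) * s)) F ((n + 1 : ℕ) * s)
      ((n + 1 : ℕ) * δ) := by
  induction n with
  | zero => simpa using h
  | succ n ih =>
    have := ih.conv hp hF hR hF' hL h
    rw [scaledGaussian_conv (by positivity) hs] at this
    convert this using 1 <;> push_cast <;> ring_nf

/-- The functional inequality of a Gaussian, for functions bounded away from zero. -/
theorem phiEntropy_scaledGaussian_le_of_pos (hp : IsEntropyPair φ ψ) {F : E → ℝ} {c ε t : ℝ}
    (hF : ContDiff ℝ ∞ F) (hc : HasCompactSupport fun x => F x - c) (hε : 0 < ε)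
    (hFε : ∀ x, ε ≤ F x) (ht : 0 ≤ t) :
    phiEntropy φ ψ (scaledGaussian E t) F ≤
      t * ∫ x, ‖fderiv ℝ F x‖ ^ 2 ∂(scaledGaussian E t) := by
  obtain ⟨R, L, M, -, -, hR, hL, -⟩ := exists_regularity_bounds hF hc
  obtain ⟨K, hK⟩ := exists_hasTranslateBound_scaledGaussian hp hF hc hε hFε
  have key : ∀ n : ℕ, phiEntropy φ ψ (scaledGaussian E t) F ≤
      t * ∫ x, ‖fderiv ℝ F x‖ ^ 2 ∂(scaledGaussian E t) +
        K * (t * Real.sqrt (t / (n + 1 : ℕ)) + t * (t / (n + 1 : ℕ))) := by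
    intro n
    have hn : ((n + 1 : ℕ) : ℝ) ≠ 0 := by positivity
    have h0 : 0 ≤ t / (n + 1 : ℕ) := by positivity
    have := (hK _ h0).scaledGaussian_mul hp hF.continuous hR (hF.continuous_fderiv (by simp)) hL
      h0 n 0
    rw [mul_div_cancel₀ _ hn] at this
    simp only [zero_add] at this
    refine this.trans_eq ?_
    congr 1
    field_simp
  have hlim : Filter.Tendsto (fun n : ℕ => t / ((n + 1 : ℕ) : ℝ)) Filter.atTop (nhds 0) :=
    (tendsto_const_div_atTop_nhds_zero_nat t).comp (Filter.tendsto_add_atTop_nat 1)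
  have hlim2 := (hlim.sqrt.const_mul t).add (hlim.const_mul t)
  have := ge_of_tendsto' ((hlim2.const_mul K).const_add _) key
  simpa using this

end Gaussian

/-! ### Limits of functional inequalities -/

section Limits

/-- Dominated convergence for the `φ`-entropy. -/
theorem tendsto_phiEntropy {φ ψ : ℝ → ℝ} (hp : IsEntropyPair φ ψ) {Ω : Type*} [MeasurableSpace Ω]
    {μ : Measure Ω} [IsProbabilityMeasure μ] {f : ℕ → Ω → ℝ} {f₀ g : Ω → ℝ}
    (hf : ∀ n, Measurable (f n)) (hfg : ∀ n x, |f n x| ≤ g x)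
    (hg : Integrable (fun x => g x ^ 4) μ)
    (hlim : ∀ x, Filter.Tendsto (fun n => f n x) Filter.atTop (nhds (f₀ x))) :
    Filter.Tendsto (fun n => phiEntropy φ ψ μ (f n)) Filter.atTop
      (nhds (phiEntropy φ ψ μ f₀)) := by
  obtain ⟨C, hC⟩ := hp.growth
  have hC0 : 0 ≤ C := by simpa using (abs_nonneg _).trans (hC 0).1
  have hφ := hp.continuous_phi
  have hψ := hp.continuous_psi
  have hφψ : Continuous fun u => φ (ψ u) := hφ.comp hψ
  have hi : Integrable (fun x => C * (1 + g x ^ 4)) μ := ((integrable_const 1).add hg).const_mul C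
  have hb : ∀ n x, C * (1 + f n x ^ 4) ≤ C * (1 + g x ^ 4) := by
    intro n x
    have : f n x ^ 4 ≤ g x ^ 4 := by
      rw [← Even.pow_abs (by decide : Even 4) (f n x)]
      exact pow_le_pow_left₀ (abs_nonneg _) (hfg n x) 4
    gcongr
  have h1 : Filter.Tendsto (fun n => ∫ x, φ (ψ (f n x)) ∂μ) Filter.atTop
      (nhds (∫ x, φ (ψ (f₀ x)) ∂μ)) :=
    tendsto_integral_of_dominated_convergence _
      (fun n => (hφψ.measurable.comp (hf n)).aestronglyMeasurable) hi
      (fun n => ae_of_all _ fun x => (hC _).2.trans (hb n x))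
      (ae_of_all _ fun x => (hφψ.tendsto _).comp (hlim x))
  have h2 : Filter.Tendsto (fun n => ∫ x, ψ (f n x) ∂μ) Filter.atTop
      (nhds (∫ x, ψ (f₀ x) ∂μ)) :=
    tendsto_integral_of_dominated_convergence _
      (fun n => (hψ.measurable.comp (hf n)).aestronglyMeasurable) hi
      (fun n => ae_of_all _ fun x => (hC _).1.trans (hb n x))
      (ae_of_all _ fun x => (hψ.tendsto _).comp (hlim x))
  exact h1.sub ((hφ.tendsto _).comp h2)

variable {E : Type} [NormedAddCommGroup E] [InnerProductSpace ℝ E] [FiniteDimensional ℝ E]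
  [MeasurableSpace E] [BorelSpace E] {φ ψ : ℝ → ℝ}

/-- A functional inequality on `C_c^∞` extends, by cut-off, to smooth functions in `L⁴` with
square-integrable gradient. -/
theorem SatisfiesPhiSobolev.le_of_integrable (hp : IsEntropyPair φ ψ) {μ : Measure E}
    [IsProbabilityMeasure μ] {C : ℝ} (h : SatisfiesPhiSobolev φ ψ μ C) {f : E → ℝ}
    (hf : ContDiff ℝ ∞ f) (hf4 : Integrable (fun x => f x ^ 4) μ)
    (hf2 : Integrable (fun x => ‖fderiv ℝ f x‖ ^ 2) μ) :
    phiEntropy φ ψ μ f ≤ C * ∫ x, ‖fderiv ℝ f x‖ ^ 2 ∂μ := by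
  let χ : ContDiffBump (0 : E) := ⟨1, 2, one_pos, one_lt_two⟩
  have hχ : ContDiff ℝ ∞ χ := χ.contDiff
  obtain ⟨-, L, -, hL⟩ := exists_abs_le_of_hasCompactSupport hχ χ.hasCompactSupport
  have hL0 : 0 ≤ L := (norm_nonneg _).trans (hL 0)
  obtain ⟨r, hr⟩ : ∃ r : ℕ → ℝ, r = fun n : ℕ => 1 / ((n : ℝ) + 1) := ⟨_, rfl⟩
  have hr0 : ∀ n, 0 < r n := fun n => by rw [hr]; positivity
  have hr1 : ∀ n, r n ≤ 1 := fun n => by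
    rw [hr]; exact (div_le_one (by positivity)).2 (by linarith [n.cast_nonneg (α := ℝ)])
  have hrlim : Filter.Tendsto r Filter.atTop (nhds 0) :=
    hr ▸ tendsto_one_div_add_atTop_nhds_zero_nat
  have hrx : ∀ x : E, Filter.Tendsto (fun n => r n • x) Filter.atTop (nhds 0) := fun x => by
    simpa using hrlim.smul_const x
  have hχn : ∀ n, ContDiff ℝ ∞ fun x : E => χ (r n • x) := fun n => hχ.comp (by fun_prop)
  have hsm : ∀ n, ContDiff ℝ ∞ fun x : E => χ (r n • x) * f x := fun n => (hχn n).mul hf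
  have hcs : ∀ n, HasCompactSupport fun x : E => χ (r n • x) * f x := fun n =>
    (χ.hasCompactSupport.comp_homeomorph (Homeomorph.smulOfNeZero (r n) (hr0 n).ne')).mul_right
  have hχ1 : ∀ x, |χ x| ≤ 1 := fun x => by rw [abs_of_nonneg χ.nonneg]; exact χ.le_one
  have hder : ∀ n x, fderiv ℝ (fun x : E => χ (r n • x) * f x) x =
      χ (r n • x) • fderiv ℝ f x + f x • r n • fderiv ℝ χ (r n • x) := by
    intro n x
    rw [fderiv_fun_mul ((hχn n).differentiable (by simp) x) (hf.differentiable (by simp) x),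
      fderiv_comp_smul]
  have hderc : ∀ n, Continuous (fderiv ℝ fun x : E => χ (r n • x) * f x) :=
    fun n => (hsm n).continuous_fderiv (by simp)
  have t1 : Filter.Tendsto (fun n => phiEntropy φ ψ μ fun x => χ (r n • x) * f x) Filter.atTop
      (nhds (phiEntropy φ ψ μ f)) := by
    refine tendsto_phiEntropy hp (g := fun x => |f x|) (fun n => (hsm n).continuous.measurable)
      (fun n x => ?_) (by simpa only [Even.pow_abs (by decide : Even 4)] using hf4) (fun x => ?_)
    · rw [abs_mul]
      exact mul_le_of_le_one_left (abs_nonneg _) (hχ1 _)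
    · have : Filter.Tendsto (fun n => χ (r n • x)) Filter.atTop (nhds (χ 0)) :=
        (hχ.continuous.tendsto 0).comp (hrx x)
      rw [χ.one_of_mem_closedBall (by simp [χ])] at this
      simpa using this.mul_const (f x)
  have t2 : Filter.Tendsto (fun n => ∫ x, ‖fderiv ℝ (fun x : E => χ (r n • x) * f x) x‖ ^ 2 ∂μ)
      Filter.atTop (nhds (∫ x, ‖fderiv ℝ f x‖ ^ 2 ∂μ)) := by
    refine tendsto_integral_of_dominated_convergence
      (fun x => 2 * ‖fderiv ℝ f x‖ ^ 2 + 2 * L ^ 2 * (1 + f x ^ 4))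
      (fun n => ((hderc n).norm.pow 2).aestronglyMeasurable)
      ((hf2.const_mul 2).add (((integrable_const 1).add hf4).const_mul _))
      (fun n => ae_of_all _ fun x => ?_) (ae_of_all _ fun x => ?_)
    · rw [Real.norm_of_nonneg (sq_nonneg _), hder]
      have h1 : ‖χ (r n • x) • fderiv ℝ f x + f x • r n • fderiv ℝ χ (r n • x)‖ ≤
          ‖fderiv ℝ f x‖ + |f x| * L := by
        refine (norm_add_le _ _).trans (add_le_add ?_ ?_)
        · rw [norm_smul]
          exact mul_le_of_le_one_left (norm_nonneg _) (hχ1 _)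
        · rw [norm_smul, norm_smul, Real.norm_eq_abs, Real.norm_of_nonneg (hr0 n).le]
          refine mul_le_mul_of_nonneg_left ?_ (abs_nonneg _)
          exact (mul_le_of_le_one_left (norm_nonneg _) (hr1 n)).trans (hL _)
      have h2 := pow_le_pow_left₀ (norm_nonneg _) h1 2
      have h3 : f x ^ 2 ≤ 1 + f x ^ 4 := by nlinarith [sq_nonneg (f x ^ 2 - 1)]
      have h4 := mul_le_mul_of_nonneg_left h3 (by positivity : 0 ≤ 2 * L ^ 2)
      nlinarith [sq_nonneg (‖fderiv ℝ f x‖ - |f x| * L), sq_abs (f x)]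
    · simp only [hder]
      have c1 : Filter.Tendsto (fun n => χ (r n • x)) Filter.atTop (nhds (χ 0)) :=
        (hχ.continuous.tendsto 0).comp (hrx x)
      rw [χ.one_of_mem_closedBall (by simp [χ])] at c1
      have c2 : Filter.Tendsto (fun n => fderiv ℝ χ (r n • x)) Filter.atTop
          (nhds (fderiv ℝ χ 0)) :=
        ((hχ.continuous_fderiv (by simp)).tendsto 0).comp (hrx x)
      have := ((c1.smul_const (fderiv ℝ f x)).add ((hrlim.smul c2).const_smul (f x))).norm.pow 2
      simpa using this
  refine le_of_tendsto_of_tendsto' t1 (t2.const_mul C) fun n => ?_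
  simpa only [norm_gradient_eq] using h _ (hsm n) (hcs n)

end Limits

/-! ### The Poincaré and log-Sobolev inequalities of a Gaussian and their sharpness -/

section GaussianConstants

/-- Regularizing `|f|` to `√(f² + ε²)` does not increase the gradient. -/
theorem norm_fderiv_sqrt_sq_add_le {E : Type*} [NormedAddCommGroup E] [NormedSpace ℝ E]
    {f : E → ℝ} {x : E} {ε : ℝ} (hf : DifferentiableAt ℝ f x)
    (hε : 0 < ε) : ‖fderiv ℝ (fun x => Real.sqrt (f x ^ 2 + ε ^ 2)) x‖ ≤ ‖fderiv ℝ f x‖ := by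
  have h0 : 0 < f x ^ 2 + ε ^ 2 := by positivity
  have h1 := ((hf.hasFDerivAt.pow 2).add_const (ε ^ 2)).sqrt h0.ne'
  have h2 : |f x| ≤ Real.sqrt (f x ^ 2 + ε ^ 2) := Real.abs_le_sqrt (by nlinarith)
  have h3 : 0 < Real.sqrt (f x ^ 2 + ε ^ 2) := Real.sqrt_pos.2 h0
  rw [h1.fderiv, smul_smul, norm_smul]
  refine mul_le_of_le_one_left (norm_nonneg _) ?_
  rw [Real.norm_eq_abs, abs_mul,
    abs_of_pos (by positivity : 0 < 1 / (2 * Real.sqrt (f x ^ 2 + ε ^ 2))),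
    one_div_mul_eq_div, div_le_one (by positivity)]
  simpa [abs_mul] using h2

variable {E : Type} [NormedAddCommGroup E] [InnerProductSpace ℝ E] [FiniteDimensional ℝ E]
  [MeasurableSpace E] [BorelSpace E] {φ ψ : ℝ → ℝ}

theorem phiEntropy_sq_eq_variance {Ω : Type*} [MeasurableSpace Ω] {μ : Measure Ω}
    [IsProbabilityMeasure μ] {f : Ω → ℝ} (hf : MemLp f 2 μ) :
    phiEntropy (fun u => u ^ 2) (fun u => u) μ f = variance f μ := by
  rw [variance_eq_sub hf]; rfl

/-- The Gaussian Poincaré inequality. -/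
theorem satisfiesPhiSobolev_variance_scaledGaussian {t : ℝ} (ht : 0 ≤ t) :
    SatisfiesPhiSobolev (fun u => u ^ 2) (fun u => u) (scaledGaussian E t) t := by
  intro f hf hc
  obtain ⟨R, L, hR, -⟩ := exists_abs_le_of_hasCompactSupport hf hc
  have hfm : MemLp f 2 (scaledGaussian E t) :=
    MemLp.of_bound hf.continuous.aestronglyMeasurable R (ae_of_all _ hR)
  have := phiEntropy_scaledGaussian_le_of_pos (E := E) isEntropyPair_variance
    (F := fun x => f x + (R + 1)) (c := R + 1) (ε := 1) (t := t) (hf.add contDiff_const)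
    (by simpa using hc) one_pos (fun x => by linarith [(abs_le.1 (hR x)).1]) ht
  have hfm' : MemLp (fun x => f x + (R + 1)) 2 (scaledGaussian E t) := hfm.add (memLp_const _)
  rw [phiEntropy_sq_eq_variance hfm',
    variance_add_const hf.continuous.aestronglyMeasurable] at this
  rw [phiEntropy_sq_eq_variance hfm]
  simpa only [norm_gradient_eq, fderiv_add_const] using this

/-- The Gaussian log-Sobolev inequality. -/
theorem satisfiesPhiSobolev_entropy_scaledGaussian {t : ℝ} (ht : 0 ≤ t) :
    SatisfiesPhiSobolev (fun u => u * Real.log u / 2) (fun u => u ^ 2) (scaledGaussian E t) t := by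
  intro f hf hc
  obtain ⟨R, L, hR, hL⟩ := exists_abs_le_of_hasCompactSupport hf hc
  have hR0 : 0 ≤ R := (abs_nonneg _).trans (hR 0)
  obtain ⟨r, hr⟩ : ∃ r : ℕ → ℝ, r = fun n : ℕ => 1 / ((n : ℝ) + 1) := ⟨_, rfl⟩
  have hr0 : ∀ n, 0 < r n := fun n => by rw [hr]; positivity
  have hr1 : ∀ n, r n ≤ 1 := fun n => by
    rw [hr]; exact (div_le_one (by positivity)).2 (by linarith [n.cast_nonneg (α := ℝ)])
  have hrlim : Filter.Tendsto r Filter.atTop (nhds 0) :=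
    hr ▸ tendsto_one_div_add_atTop_nhds_zero_nat
  have hsm : ∀ n, ContDiff ℝ ∞ fun x => Real.sqrt (f x ^ 2 + r n ^ 2) := fun n =>
    ((hf.pow 2).add contDiff_const).sqrt fun x => by have := hr0 n; positivity
  have hint : Integrable (fun x => ‖fderiv ℝ f x‖ ^ 2) (scaledGaussian E t) := by
    refine integrable_of_abs_le (B := L ^ 2)
      ((hf.continuous_fderiv (by simp)).norm.pow 2).measurable fun x => ?_
    rw [abs_of_nonneg (sq_nonneg _)]
    exact pow_le_pow_left₀ (norm_nonneg _) (hL _) 2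
  have key : ∀ n, phiEntropy (fun u => u * Real.log u / 2) (fun u => u ^ 2) (scaledGaussian E t)
      (fun x => Real.sqrt (f x ^ 2 + r n ^ 2)) ≤
      t * ∫ x, ‖fderiv ℝ f x‖ ^ 2 ∂(scaledGaussian E t) := by
    intro n
    refine (phiEntropy_scaledGaussian_le_of_pos (E := E) isEntropyPair_entropy (c := r n)
      (ε := r n) (t := t) (hsm n) ?_ (hr0 n)
      (fun x => Real.le_sqrt_of_sq_le (by nlinarith)) ht).trans ?_
    · exact hc.comp_left (g := fun u => Real.sqrt (u ^ 2 + r n ^ 2) - r n)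
        (by simp [Real.sqrt_sq (hr0 n).le])
    · refine mul_le_mul_of_nonneg_left (integral_mono_of_nonneg (ae_of_all _ fun x => sq_nonneg _)
        hint (ae_of_all _ fun x => ?_)) ht
      exact pow_le_pow_left₀ (norm_nonneg _)
        (norm_fderiv_sqrt_sq_add_le (hf.differentiable (by simp) x) (hr0 n)) 2
  have hlim := tendsto_phiEntropy isEntropyPair_entropy (μ := scaledGaussian E t)
    (f := fun n x => Real.sqrt (f x ^ 2 + r n ^ 2)) (f₀ := fun x => |f x|)
    (g := fun _ => R + 1) (fun n => (hsm n).continuous.measurable) (fun n x => ?_)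
    (integrable_const _) (fun x => ?_)
  · have := le_of_tendsto' hlim key
    simpa only [phiEntropy, sq_abs, norm_gradient_eq] using this
  · rw [abs_of_nonneg (Real.sqrt_nonneg _)]
    have h1 : f x ^ 2 ≤ R ^ 2 := sq_le_sq' (abs_le.1 (hR x)).1 (abs_le.1 (hR x)).2
    exact Real.sqrt_le_iff.2 ⟨by linarith, by nlinarith [hr0 n, hr1 n]⟩
  · have := ((hrlim.pow 2).const_add (f x ^ 2)).sqrt
    simpa [Real.sqrt_sq_eq_abs] using this

theorem map_dual_scaledGaussian {t : ℝ} (ht : 0 ≤ t) {ℓ : StrongDual ℝ E} (hℓ : ‖ℓ‖ = 1) :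
    (scaledGaussian E t).map ℓ = gaussianReal 0 t.toNNReal := by
  have h1 : (stdGaussian E).map ℓ = gaussianReal 0 1 := by
    rw [IsGaussian.map_eq_gaussianReal, integral_strongDual_stdGaussian, variance_dual_stdGaussian,
      hℓ]
    simp
  have h2 : (ℓ : E → ℝ) ∘ (fun x => Real.sqrt t • x) = (fun u => Real.sqrt t * u) ∘ ℓ := by
    ext x; simp
  rw [scaledGaussian, Measure.map_map (by fun_prop) (by fun_prop), h2,
    ← Measure.map_map (by fun_prop) (by fun_prop), h1, gaussianReal_map_const_mul]
  congr 1
  · simp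
  · ext; simp [Real.sq_sqrt ht, ht]

/-- Sharpness of the Poincaré inequality: linear functions are extremal. -/
theorem le_of_satisfiesPhiSobolev_variance {t C : ℝ} (ht : 0 ≤ t) {ℓ : StrongDual ℝ E}
    (hℓ : ‖ℓ‖ = 1) (h : SatisfiesPhiSobolev (fun u => u ^ 2) (fun u => u) (scaledGaussian E t) C) :
    t ≤ C := by
  have hmap := map_dual_scaledGaussian ht hℓ
  have hmem : ∀ p : ℝ≥0, MemLp ℓ p (scaledGaussian E t) := fun p => by
    have := memLp_id_gaussianReal (μ := 0) (v := t.toNNReal) p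
    rw [← hmap] at this
    exact this.comp_of_map (by fun_prop)
  have h4 : Integrable (fun x => ℓ x ^ 4) (scaledGaussian E t) := by
    have := (hmem 4).integrable_norm_pow (p := 4) (by norm_num)
    simpa only [Real.norm_eq_abs, Even.pow_abs (by decide : Even 4)] using this
  have := h.le_of_integrable isEntropyPair_variance ℓ.contDiff h4 (by simp)
  rw [phiEntropy_sq_eq_variance (hmem 2)] at this
  have hv : variance ℓ (scaledGaussian E t) = t := by
    have h1 := variance_id_gaussianReal (μ := 0) (v := t.toNNReal)
    rw [← hmap, variance_map (by fun_prop) (by fun_prop)] at h1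
    simpa [ht] using h1
  simpa [hv, hℓ] using this

/-- Sharpness of the log-Sobolev inequality: exponentials of linear functions are extremal. -/
theorem le_of_satisfiesPhiSobolev_entropy {t C : ℝ} (ht : 0 ≤ t) {ℓ : StrongDual ℝ E}
    (hℓ : ‖ℓ‖ = 1) (h : SatisfiesPhiSobolev (fun u => u * Real.log u / 2) (fun u => u ^ 2)
      (scaledGaussian E t) C) :
    t ≤ C := by
  have hmap := map_dual_scaledGaussian ht hℓ
  have hexp : ∀ a : ℝ, Integrable (fun x => Real.exp (a * ℓ x)) (scaledGaussian E t) := fun a => by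
    have := integrable_exp_mul_gaussianReal (μ := 0) (v := t.toNNReal) a
    rw [← hmap] at this
    exact this.comp_measurable (by fun_prop)
  have hmgf : mgf ℓ (scaledGaussian E t) = fun a => Real.exp (t * a ^ 2 / 2) := by
    ext a; rw [mgf_gaussianReal hmap]; simp [ht]
  have hset : integrableExpSet ℓ (scaledGaussian E t) = univ := by
    ext a; simpa [integrableExpSet] using hexp a
  have hX : ∫ x, ℓ x * Real.exp (ℓ x) ∂(scaledGaussian E t) = t * Real.exp (t / 2) := by
    have h1 := hasDerivAt_mgf (X := ℓ) (μ := scaledGaussian E t) (t := 1) (by simp [hset])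
    rw [hmgf] at h1
    have h2 : HasDerivAt (fun a : ℝ => Real.exp (t * a ^ 2 / 2))
        (Real.exp (t * 1 ^ 2 / 2) * (t * (2 * 1 ^ 1) / 2)) 1 := by
      refine HasDerivAt.exp (HasDerivAt.div_const (HasDerivAt.const_mul t ?_) 2)
      simpa using hasDerivAt_pow 2 (1 : ℝ)
    have h3 := h1.unique h2
    simp only [one_mul] at h3
    rw [h3]
    ring_nf
  have hE : ∫ x, Real.exp (ℓ x) ∂(scaledGaussian E t) = Real.exp (t / 2) := by
    have := congrFun hmgf 1
    simpa [mgf] using this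
  have hder : ∀ x, HasFDerivAt (fun x => Real.exp (ℓ x / 2))
      (Real.exp (ℓ x / 2) • ((1 / 2 : ℝ) • ℓ)) x := by
    intro x
    refine HasFDerivAt.exp ?_
    simpa [div_eq_inv_mul] using ℓ.hasFDerivAt.const_mul (1 / 2 : ℝ) (x := x)
  have hsq : ∀ x, Real.exp (ℓ x / 2) ^ 2 = Real.exp (ℓ x) := fun x => by
    rw [← Real.exp_nat_mul]; congr 1; push_cast; ring
  have hnorm : ∀ x, ‖fderiv ℝ (fun x => Real.exp (ℓ x / 2)) x‖ ^ 2 = Real.exp (ℓ x) / 4 := by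
    intro x
    rw [(hder x).fderiv, norm_smul, norm_smul, hℓ, mul_pow, Real.norm_eq_abs, sq_abs, hsq]
    norm_num
    ring
  have hsm : ContDiff ℝ ∞ fun x => Real.exp (ℓ x / 2) := (ℓ.contDiff.div_const 2).exp
  have := h.le_of_integrable isEntropyPair_entropy hsm ?_ ?_
  · simp only [hnorm, phiEntropy, hsq, Real.log_exp, hE, integral_div] at this
    simp only [mul_comm (Real.exp (ℓ _)), hX] at this
    have hpos := Real.exp_pos (t / 2)
    have h2 : (C - t) * Real.exp (t / 2) ≥ 0 := by linarith
    nlinarith [nonneg_of_mul_nonneg_left h2 hpos]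
  · refine (hexp 2).congr (ae_of_all _ fun x => ?_)
    simp only
    rw [← Real.exp_nat_mul]; congr 1; push_cast; ring
  · simp only [hnorm]
    simpa using (hexp 1).div_const 4

end GaussianConstants

/-! ### Best constants -/

section Constants

variable {E : Type} [NormedAddCommGroup E] [InnerProductSpace ℝ E] [FiniteDimensional ℝ E]
  [MeasurableSpace E] {φ ψ : ℝ → ℝ} {μ : Measure E}

/-- The best constant in the functional inequality `SatisfiesPhiSobolev`, `∞` if there is none. -/
noncomputable def phiSobolevConst (φ ψ : ℝ → ℝ) (μ : Measure E) : ℝ≥0∞ :=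
  ⨅ (C : ℝ≥0) (_ : SatisfiesPhiSobolev φ ψ μ C), (C : ℝ≥0∞)

theorem SatisfiesPhiSobolev.const_le {C : ℝ} (hC : 0 ≤ C) (h : SatisfiesPhiSobolev φ ψ μ C) :
    phiSobolevConst φ ψ μ ≤ ENNReal.ofReal C :=
  iInf₂_le C.toNNReal (by rwa [Real.coe_toNNReal C hC])

/-- A finite best constant is admissible. -/
theorem satisfiesPhiSobolev_const (h : phiSobolevConst φ ψ μ < ⊤) :
    SatisfiesPhiSobolev φ ψ μ (phiSobolevConst φ ψ μ).toReal := by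
  intro f hf hc
  have hG : 0 ≤ ∫ x, ‖gradient f x‖ ^ 2 ∂μ := integral_nonneg fun x => sq_nonneg _
  have key : ∀ ε : ℝ, 0 < ε → phiEntropy φ ψ μ f ≤
      ((phiSobolevConst φ ψ μ).toReal + ε) * ∫ x, ‖gradient f x‖ ^ 2 ∂μ := by
    intro ε hε
    have h1 : phiSobolevConst φ ψ μ < phiSobolevConst φ ψ μ + ENNReal.ofReal ε :=
      ENNReal.lt_add_right h.ne (by simpa using hε)
    obtain ⟨C, hC⟩ := iInf_lt_iff.1 h1
    obtain ⟨hCs, hC⟩ := iInf_lt_iff.1 hC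
    refine (hCs f hf hc).trans (mul_le_mul_of_nonneg_right ?_ hG)
    have := ENNReal.toReal_mono (ENNReal.add_ne_top.2 ⟨h.ne, ENNReal.ofReal_ne_top⟩) hC.le
    rwa [ENNReal.toReal_add h.ne (by finiteness), ENNReal.toReal_ofReal hε.le,
      ENNReal.coe_toReal] at this
  have hlim : Filter.Tendsto (fun ε : ℝ => ((phiSobolevConst φ ψ μ).toReal + ε) *
      ∫ x, ‖gradient f x‖ ^ 2 ∂μ) (nhdsWithin 0 (Ioi 0))
      (nhds (((phiSobolevConst φ ψ μ).toReal + 0) * ∫ x, ‖gradient f x‖ ^ 2 ∂μ)) :=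
    ((Filter.tendsto_id.const_add _).mul_const _).mono_left nhdsWithin_le_nhds
  rw [add_zero] at hlim
  exact ge_of_tendsto hlim (eventually_mem_nhdsWithin.mono fun ε hε => key ε hε)

theorem phiSobolevConst_eq {t : ℝ} (ht : 0 ≤ t) (h : SatisfiesPhiSobolev φ ψ μ t)
    (h' : ∀ C, SatisfiesPhiSobolev φ ψ μ C → t ≤ C) :
    phiSobolevConst φ ψ μ = ENNReal.ofReal t :=
  le_antisymm (h.const_le ht) (le_iInf₂ fun C hC => ENNReal.ofReal_le_of_le_toReal (h' C hC))

/-- The bound along the diffusion path, for any pair of endpoints with finite constants. -/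
theorem phiSobolevConst_interpolation_le [BorelSpace E] (hp : IsEntropyPair φ ψ)
    {π ν : Measure E} [IsProbabilityMeasure π] [IsProbabilityMeasure ν]
    (hπ : phiSobolevConst φ ψ π < ⊤) (hν : phiSobolevConst φ ψ ν < ⊤) {l : ℝ}
    (hl : l ∈ Icc (0 : ℝ) 1) :
    phiSobolevConst φ ψ
        ((π.map fun x => Real.sqrt l • x).conv (ν.map fun z => Real.sqrt (1 - l) • z)) ≤
      ENNReal.ofReal l * phiSobolevConst φ ψ π +
        ENNReal.ofReal (1 - l) * phiSobolevConst φ ψ ν := by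
  have hl1 : 0 ≤ 1 - l := sub_nonneg.2 hl.2
  have : IsProbabilityMeasure (π.map fun x => Real.sqrt l • x) :=
    Measure.isProbabilityMeasure_map (by fun_prop)
  have : IsProbabilityMeasure (ν.map fun x => Real.sqrt (1 - l) • x) :=
    Measure.isProbabilityMeasure_map (by fun_prop)
  have hφ := hp.continuous_phi
  have hψ := hp.continuous_psi
  have h := ((satisfiesPhiSobolev_const hπ).map_smul hφ hψ (Real.sqrt l)).conv hp
    ((satisfiesPhiSobolev_const hν).map_smul hφ hψ (Real.sqrt (1 - l)))
  rw [Real.sq_sqrt hl.1, Real.sq_sqrt hl1] at h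
  have h1 := mul_nonneg hl.1 (ENNReal.toReal_nonneg (a := phiSobolevConst φ ψ π))
  have h2 := mul_nonneg hl1 (ENNReal.toReal_nonneg (a := phiSobolevConst φ ψ ν))
  refine (h.const_le (add_nonneg h1 h2)).trans_eq ?_
  rw [ENNReal.ofReal_add h1 h2, ENNReal.ofReal_mul hl.1, ENNReal.ofReal_mul hl1,
    ENNReal.ofReal_toReal hπ.ne, ENNReal.ofReal_toReal hν.ne]

end Constants

theorem poincareConst_eq_phiSobolevConst {d : ℕ} (μ : Measure (EuclideanSpace ℝ (Fin d)))
    [IsProbabilityMeasure μ] :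
    poincareConst μ = phiSobolevConst (fun u => u ^ 2) (fun u => u) μ := by
  have : ∀ C : ℝ≥0, SatisfiesPoincare μ C ↔
      SatisfiesPhiSobolev (fun u => u ^ 2) (fun u => u) μ C := by
    intro C
    refine forall_congr' fun f => forall_congr' fun hf => forall_congr' fun hc => ?_
    obtain ⟨R, -, hR, -⟩ := exists_abs_le_of_hasCompactSupport hf hc
    rw [phiEntropy_sq_eq_variance
      (MemLp.of_bound hf.continuous.aestronglyMeasurable R (ae_of_all _ hR))]
  simp only [poincareConst, phiSobolevConst, this]

theorem logSobolevConst_eq_phiSobolevConst {d : ℕ} (μ : Measure (EuclideanSpace ℝ (Fin d))) :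
    logSobolevConst μ = phiSobolevConst (fun u => u * Real.log u / 2) (fun u => u ^ 2) μ := by
  have : ∀ C : ℝ≥0, SatisfiesLogSobolev μ C ↔
      SatisfiesPhiSobolev (fun u => u * Real.log u / 2) (fun u => u ^ 2) μ C := by
    intro C
    refine forall_congr' fun f => forall_congr' fun hf => forall_congr' fun hc => ?_
    simp only [entropyFunctional, phiEntropy, integral_div]
    constructor <;> intro h <;> linarith
  simp only [logSobolevConst, phiSobolevConst, this]

theorem isotropicGaussian_eq_scaledGaussian (d : ℕ) (σ : ℝ) :
    isotropicGaussian d σ = scaledGaussian (EuclideanSpace ℝ (Fin d)) (σ ^ 2) := by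
  have hS : (σ ^ 2 • (1 : Matrix (Fin d) (Fin d) ℝ)).PosSemidef :=
    Matrix.PosSemidef.one.smul (sq_nonneg σ)
  have : IsProbabilityMeasure (isotropicGaussian d σ) := by
    unfold isotropicGaussian; infer_instance
  refine Measure.ext_of_charFun (funext fun t => ?_)
  rw [charFun_scaledGaussian (sq_nonneg σ), isotropicGaussian, charFun_multivariateGaussian hS,
    inner_zero_right, ← Complex.ofReal_pow, EuclideanSpace.real_norm_sq_eq]
  congr 1
  simp [Matrix.smul_mulVec, dotProduct, Finset.mul_sum, sq, neg_div]
  exact Finset.sum_congr rfl fun i _ => by ring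

theorem mainTheorem10 (d : ℕ) (hd : 1 ≤ d) (σ : ℝ) (hσ : 0 < σ) (T : ℝ) (hT : 0 < T)
    (l : ℝ → ℝ) (hl : IsSchedule T l)
    (π : Measure (EuclideanSpace ℝ (Fin d))) [IsProbabilityMeasure π] :
    (logSobolevConst π < (⊤ : ℝ≥0∞) → ∀ t ∈ Icc 0 T,
      logSobolevConst (diffusionPath π (isotropicGaussian d σ) l t) ≤
        ENNReal.ofReal (l t) * logSobolevConst π +
          ENNReal.ofReal (1 - l t) * logSobolevConst (isotropicGaussian d σ)) ∧
    (poincareConst π < (⊤ : ℝ≥0∞) → ∀ t ∈ Icc 0 T,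
      poincareConst (diffusionPath π (isotropicGaussian d σ) l t) ≤
        ENNReal.ofReal (l t) * poincareConst π +
          ENNReal.ofReal (1 - l t) * poincareConst (isotropicGaussian d σ)) ∧
    logSobolevConst (isotropicGaussian d σ) = ENNReal.ofReal (σ ^ 2) ∧
    poincareConst (isotropicGaussian d σ) = ENNReal.ofReal (σ ^ 2) := by

  have hσ2 : 0 ≤ σ ^ 2 := sq_nonneg σ
  obtain ⟨ℓ, hℓ⟩ : ∃ ℓ : StrongDual ℝ (EuclideanSpace ℝ (Fin d)), ‖ℓ‖ = 1 :=
    ⟨innerSL ℝ (EuclideanSpace.single (⟨0, hd⟩ : Fin d) (1 : ℝ)), by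
      rw [innerSL_apply_norm]; simp⟩
  have hLS := phiSobolevConst_eq hσ2
    (satisfiesPhiSobolev_entropy_scaledGaussian (E := EuclideanSpace ℝ (Fin d)) hσ2)
    fun C hC => le_of_satisfiesPhiSobolev_entropy hσ2 hℓ hC
  have hPI := phiSobolevConst_eq hσ2
    (satisfiesPhiSobolev_variance_scaledGaussian (E := EuclideanSpace ℝ (Fin d)) hσ2)
    fun C hC => le_of_satisfiesPhiSobolev_variance hσ2 hℓ hC
  simp only [logSobolevConst_eq_phiSobolevConst, isotropicGaussian_eq_scaledGaussian]
  rw [poincareConst_eq_phiSobolevConst, poincareConst_eq_phiSobolevConst]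
  refine ⟨fun hπ t ht => ?_, fun hπ t ht => ?_, hLS, hPI⟩
  · exact phiSobolevConst_interpolation_le isEntropyPair_entropy hπ
      (hLS ▸ ENNReal.ofReal_lt_top) (hl.mem_Icc t ht)
  · have : IsProbabilityMeasure (π.map fun x => Real.sqrt (l t) • x) :=
      Measure.isProbabilityMeasure_map (by fun_prop)
    have : IsProbabilityMeasure ((scaledGaussian (EuclideanSpace ℝ (Fin d)) (σ ^ 2)).map
        fun x => Real.sqrt (1 - l t) • x) := Measure.isProbabilityMeasure_map (by fun_prop)
    rw [diffusionPath, poincareConst_eq_phiSobolevConst]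
    exact phiSobolevConst_interpolation_le isEntropyPair_variance hπ
      (hPI ▸ ENNReal.ofReal_lt_top) (hl.mem_Icc t ht)
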